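/- Let $R$ be a complete, separated topological associative unital ring in which open right ideals form a base of neighborhoods of zero. Let $H\subset R$ be a two-sided ideal such that: 1. $H$ is strongly closed, i.e. $H$ is closed in $R$, the quotient group $R/H$ is complete in the quotient topology, and for every set $X$ the induced map $R[[X]]\to(R/H)[[X]]$ is surjective. Here, for a topological abelian group $A$, $A[[X]]$ denotes the group of all infinite formal linear combinations $\sum_{x\in X}a_x x$ whose coefficients $a_x\in A$ form an $X$-indexed family converging to zero (every neighborhood of zero contains all but finitely many $a_x$); 2. $H$ is topologically left T-nilpotent, i.e. for every sequence $a_1,a_2,a_3,\dots$ of elements of $H$ the sequence of products $a_1,\ a_1a_2,\ a_1a_2a_3,\dots$ converges to zero in $R$; 3. the topological quotient ring $R/H$ is isomorphic, as a topological ring, to a product $\prod_{\gamma\in\Gamma}S_\gamma$ (with the product topology) of a family of discrete rings $S_\gamma$, each of which is simple Artinian. Then every flat left $R$-contramodule is a projective object of the category of left $R$-contramodules. Here a left $R$-contramodule is an algebra over the monad $X\mapsto R[[X]]$ on the category of sets, that is, a set $C$ with a map $\pi_C\colon R[[C]]\to C$ satisfying the equations of contraunitality and contraassociativity; the unit $X\to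 R[[X]]$ of the monad sends $x_0$ to $1\cdot x_0$, and the multiplication $R[[R[[X]]]]\to R[[X]]$ opens the parentheses, $\sum_y r_y\bigl(\sum_x s_{y,x}x\bigr)\mapsto\sum_x\bigl(\sum_y r_ys_{y,x}\bigr)x$. Every left $R$-contramodule has an underlying abelian group, with $a+b=\pi_C(1\cdot a+1\cdot b)$. A right $R$-module $N$ is discrete if the annihilator in $R$ of each element of $N$ is open. The contratensor product $N\odot_R C$ of a discrete right $R$-module $N$ and a left $R$-contramodule $C$ is the cokernel of the difference of the two homomorphisms $N\otimes_{\mathbb Z}R[[C]]\rightrightarrows N\otimes_{\mathbb Z}C$ taking $b\otimes\sum_c r_c c$ to $b\otimes\pi_C\bigl(\sum_c r_c c\bigr)$ and to $\sum_c (br_c)\otimes c$, respectively (the latter sum is finite). A left $R$-contramodule $F$ is flat if the functor $N\mapsto N\odot_R F$ from discrete right $R$-modules to abelian groups is exact. -/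

import Mathlib

open Filter Topology CategoryTheory
open scoped TensorProduct MulOpposite

set_option linter.unusedSectionVars false

universe u v w

/-! ### Zero-convergent formal linear combinations -/

/-- `FormalSum A X` is the group `A[[X]]` of all infinite formal linear combinations
`∑ aₓ x` of elements of `X` whose coefficients form an `X`-indexed family converging to zero in
the topology of `A`: every neighbourhood of zero contains all but finitely many `aₓ`. -/
def FormalSum (A : Type u) [AddCommGroup A] [TopologicalSpace A] [IsTopologicalAddGroup A]
    (X : Type v) : AddSubgroup (X → A) where
  carrier := {a | Tendsto a cofinite (𝓝 0)}
  zero_mem' := tendsto_const_nhds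
  add_mem' {a b} ha hb := by
    have h := Tendsto.add (show Tendsto a cofinite (𝓝 0) from ha)
      (show Tendsto b cofinite (𝓝 0) from hb)
    rw [add_zero] at h
    exact h
  neg_mem' {a} ha := by
    have h := Tendsto.neg (show Tendsto a cofinite (𝓝 0) from ha)
    rw [neg_zero] at h
    exact h

namespace FormalSum

/-- The map `A[[X]] → B[[X]]` induced by a continuous homomorphism `f : A → B` of topological
abelian groups, applied to each coefficient. -/
def mapCoeff {A : Type u} [AddCommGroup A] [TopologicalSpace A] [IsTopologicalAddGroup A]
    {B : Type v} [AddCommGroup B] [TopologicalSpace B] [IsTopologicalAddGroup B]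
    (f : A →+ B) (hf : Continuous f) (X : Type w) : FormalSum A X →+ FormalSum B X where
  toFun r := ⟨fun x => f (r.1 x), by
    have h := (hf.tendsto 0).comp (show Tendsto r.1 cofinite (𝓝 0) from r.2)
    rw [map_zero] at h
    exact h⟩
  map_zero' := by ext x; simp
  map_add' r s := by ext x; simp

section RightLinear

/- `R` is a complete, separated topological ring in which open right ideals
(`Rᵐᵒᵖ`-submodules of `R`) form a base of neighbourhoods of zero. -/
variable {R : Type u} [Ring R] [UniformSpace R] [IsUniformAddGroup R] [IsTopologicalRing R]
  [CompleteSpace R] [T2Space R] [IsLinearTopology Rᵐᵒᵖ R]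

theorem nonarchimedean_of_rightLinear (R : Type u) [Ring R] [UniformSpace R]
    [IsUniformAddGroup R] [IsLinearTopology Rᵐᵒᵖ R] : NonarchimedeanAddGroup R where
  is_nonarchimedean U hU := by
    obtain ⟨I, hI, hIU⟩ := (IsLinearTopology.hasBasis_open_submodule (M := R) Rᵐᵒᵖ).mem_iff.1 hU
    exact ⟨⟨I.toAddSubgroup, hI⟩, hIU⟩

theorem summable_of_tendsto {X : Type v} {a : X → R} (ha : Tendsto a cofinite (𝓝 0)) :
    Summable a :=
  have := nonarchimedean_of_rightLinear R
  NonarchimedeanAddGroup.summable_of_tendsto_cofinite_zero ha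

theorem tendsto_of_rightIdeals {X : Type v} {a : X → R}
    (h : ∀ I : Submodule Rᵐᵒᵖ R, IsOpen (I : Set R) → {x | a x ∉ I}.Finite) :
    Tendsto a cofinite (𝓝 0) := by
  rw [(IsLinearTopology.hasBasis_open_submodule (M := R) Rᵐᵒᵖ).tendsto_right_iff]
  intro I hI
  exact h I hI

theorem finite_of_tendsto {X : Type v} {a : X → R} (ha : Tendsto a cofinite (𝓝 0))
    (I : Submodule Rᵐᵒᵖ R) (hI : IsOpen (I : Set R)) : {x | a x ∉ I}.Finite :=
  ha (hI.mem_nhds I.zero_mem)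

theorem tsum_mem_rightIdeal {X : Type v} {a : X → R} (I : Submodule Rᵐᵒᵖ R)
    (hI : IsOpen (I : Set R)) (h : ∀ x, a x ∈ I) : ∑' x, a x ∈ I :=
  tsum_mem (I.toAddSubgroup.isClosed_of_isOpen hI) h

theorem tendsto_fiber {X : Type v} (r : FormalSum R X) (S : Set X) :
    Tendsto (fun x : S => r.1 x) cofinite (𝓝 0) :=
  Tendsto.comp (show Tendsto r.1 cofinite (𝓝 0) from r.2)
    Subtype.val_injective.tendsto_cofinite

theorem tendsto_join {X : Type v} (r : FormalSum R (FormalSum R X)) (x : X) :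
    Tendsto (fun y : FormalSum R X => r.1 y * y.1 x) cofinite (𝓝 0) :=
  IsLinearTopology.tendsto_mul_zero_of_left r.1 (fun y => y.1 x) r.2

/-- The map `R[[f]] : R[[X]] → R[[Y]]` induced by a map of sets `f : X → Y`, taking `∑ rₓ x` to
`∑_y (∑_{f x = y} rₓ) y`, where the inner sums are limits of finite partial sums. -/
noncomputable def map {X : Type v} {Y : Type w} (f : X → Y) :
    FormalSum R X →+ FormalSum R Y where
  toFun r := ⟨fun y => ∑' x : f ⁻¹' {y}, r.1 x, by
    refine tendsto_of_rightIdeals fun I hI => ?_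
    refine ((finite_of_tendsto r.2 I hI).image f).subset fun y hy => ?_
    by_contra hc
    refine hy (tsum_mem_rightIdeal I hI fun x => ?_)
    by_contra hx
    exact hc ⟨x.1, hx, x.2⟩⟩
  map_zero' := by ext y; simp
  map_add' r s := by
    ext y
    exact (summable_of_tendsto (tendsto_fiber r _)).tsum_add
      (summable_of_tendsto (tendsto_fiber s _))

open Classical in
/-- The monad unit `X → R[[X]]`: the element `x₀` goes to the formal linear combination with
coefficient `1` at `x₀` and `0` elsewhere. -/
noncomputable def point {X : Type v} (x₀ : X) : FormalSum R X :=
  ⟨fun x => if x = x₀ then 1 else 0, by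
    refine tendsto_of_rightIdeals fun I _ => (Set.finite_singleton x₀).subset fun x hx => ?_
    by_contra hc
    exact hx (by simp [show x ≠ x₀ from hc])⟩

/-- The monad multiplication `R[[R[[X]]]] → R[[X]]` ("opening of parentheses"): it takes
`∑_y r_y y`, where `y = ∑ₓ s_{y,x} x` runs over `R[[X]]`, to `∑ₓ (∑_y r_y s_{y,x}) x`. -/
noncomputable def join {X : Type v} : FormalSum R (FormalSum R X) →+ FormalSum R X where
  toFun r := ⟨fun x => ∑' y : FormalSum R X, r.1 y * y.1 x, by
    refine tendsto_of_rightIdeals fun I hI => ?_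
    have hfin : ∀ y : FormalSum R X, {x | r.1 y * y.1 x ∉ I}.Finite := fun y => by
      refine finite_of_tendsto ?_ I hI
      have h := Tendsto.const_mul (r.1 y) (show Tendsto y.1 cofinite (𝓝 0) from y.2)
      rw [mul_zero] at h
      exact h
    refine ((finite_of_tendsto r.2 I hI).biUnion fun y _ => hfin y).subset fun x hx => ?_
    by_contra hc
    simp only [Set.mem_iUnion, not_exists, Set.mem_ofPred_eq, not_not] at hc
    refine hx (tsum_mem_rightIdeal I hI fun y => ?_)
    by_cases hy : r.1 y ∈ I
    · exact I.smul_mem (MulOpposite.op (y.1 x)) hy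
    · exact hc y hy⟩
  map_zero' := by ext x; simp
  map_add' r s := by
    ext x
    refine Eq.trans ?_ ((summable_of_tendsto (tendsto_join r x)).tsum_add
      (summable_of_tendsto (tendsto_join s x)))
    exact tsum_congr fun y => add_mul _ _ _

theorem point_self {X : Type v} (x₀ : X) : (point x₀ : FormalSum R X).1 x₀ = 1 :=
  if_pos rfl

theorem point_of_ne {X : Type v} {x₀ x : X} (h : x ≠ x₀) : (point x₀ : FormalSum R X).1 x = 0 :=
  if_neg h

theorem map_point {X : Type v} {Y : Type w} (f : X → Y) (x : X) :
    map f (point x : FormalSum R X) = point (f x) := by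
  ext y
  change ∑' z : f ⁻¹' {y}, (point x : FormalSum R X).1 z = (point (f x) : FormalSum R Y).1 y
  by_cases h : y = f x
  · subst h
    rw [tsum_eq_single ⟨x, rfl⟩, point_self, point_self]
    intro z hz
    exact point_of_ne fun hzx => hz (Subtype.ext hzx)
  · rw [point_of_ne h]
    refine (tsum_congr fun z => point_of_ne fun hzx => h ?_).trans tsum_zero
    rw [← hzx]
    exact z.2.symm

theorem join_point {X : Type v} (r : FormalSum R X) : join (point r) = r := by
  ext x
  change ∑' y : FormalSum R X, (point r : FormalSum R (FormalSum R X)).1 y * y.1 x = r.1 x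
  rw [tsum_eq_single r, point_self, one_mul]
  intro y hy
  rw [point_of_ne hy, zero_mul]

theorem map_id {X : Type v} (r : FormalSum R X) : map id r = r := by
  ext x
  change ∑' z : (id : X → X) ⁻¹' {x}, r.1 z = r.1 x
  rw [tsum_eq_single ⟨x, rfl⟩]
  intro z hz
  exact absurd (Subtype.ext (show z.1 = x from z.2)) hz

theorem map_comp {X Y Z : Type v} (f : X → Y) (g : Y → Z) (r : FormalSum R X) :
    map (g ∘ f) r = map g (map f r) := by
  ext z
  have hs : Summable fun x : (g ∘ f) ⁻¹' {z} => r.1 x := summable_of_tendsto (tendsto_fiber r _)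
  let e : (Σ y : g ⁻¹' {z}, f ⁻¹' {y.1}) ≃ ((g ∘ f) ⁻¹' {z} : Set X) :=
    { toFun := fun p => ⟨p.2.1, by
        have h1 : f p.2.1 = p.1.1 := p.2.2
        have h2 : g p.1.1 = z := p.1.2
        change g (f p.2.1) = z
        rw [h1, h2]⟩
      invFun := fun x => ⟨⟨f x.1, x.2⟩, ⟨x.1, rfl⟩⟩
      left_inv := by
        rintro ⟨⟨y, hy⟩, ⟨x, hx⟩⟩
        obtain rfl : f x = y := hx
        rfl
      right_inv := fun x => rfl }
  change ∑' x : (g ∘ f) ⁻¹' {z}, r.1 x = ∑' y : g ⁻¹' {z}, ∑' x : f ⁻¹' {y.1}, r.1 x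
  rw [← e.tsum_eq]
  exact ((e.summable_iff (f := fun x : (g ∘ f) ⁻¹' {z} => r.1 x)).2 hs).tsum_sigma

end RightLinear

end FormalSum

/-! ### Left contramodules -/

section Contramodules

/-- A left contramodule over `R`: an algebra over the monad `X ↦ R[[X]]` on the category of sets,
that is, a set with a contraaction map `R[[C]] → C` satisfying contraunitality and
contraassociativity. -/
structure Contramodule (R : Type u) [Ring R] [UniformSpace R] [IsUniformAddGroup R]
    [IsTopologicalRing R] [CompleteSpace R] [T2Space R] [IsLinearTopology Rᵐᵒᵖ R] where
  /-- the underlying set -/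
  carrier : Type u
  /-- the left contraaction map -/
  act : FormalSum R carrier → carrier
  act_point : ∀ c : carrier, act (FormalSum.point c) = c
  act_assoc : ∀ r : FormalSum R (FormalSum R carrier),
    act (FormalSum.map act r) = act (FormalSum.join r)

variable {R : Type u} [Ring R] [UniformSpace R] [IsUniformAddGroup R] [IsTopologicalRing R]
  [CompleteSpace R] [T2Space R] [IsLinearTopology Rᵐᵒᵖ R]

namespace Contramodule

/-- A morphism of left contramodules: a map of sets commuting with the contraactions. -/
@[ext]
structure Hom (C D : Contramodule R) where
  /-- the underlying map of sets -/
  toFun : C.carrier → D.carrier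
  map_act : ∀ r : FormalSum R C.carrier, toFun (C.act r) = D.act (FormalSum.map toFun r)

/-- The category of left contramodules over `R`. -/
instance : Category (Contramodule R) where
  Hom C D := Hom C D
  id C := ⟨id, fun r => by rw [FormalSum.map_id]; rfl⟩
  comp f g := ⟨g.toFun ∘ f.toFun, fun r => by
    rw [FormalSum.map_comp, ← g.map_act, ← f.map_act]; rfl⟩

/- The underlying abelian group of a left contramodule: `a + b` is the contraaction applied to the
finite formal linear combination `1 a + 1 b`, and similarly for `0` and `-a`. -/

noncomputable instance (C : Contramodule R) : Zero C.carrier := ⟨C.act 0⟩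

noncomputable instance (C : Contramodule R) : Add C.carrier :=
  ⟨fun a b => C.act (FormalSum.point a + FormalSum.point b)⟩

noncomputable instance (C : Contramodule R) : Neg C.carrier :=
  ⟨fun a => C.act (-FormalSum.point a)⟩

theorem act_add (C : Contramodule R) (r s : FormalSum R C.carrier) :
    C.act (r + s) = C.act r + C.act s := by
  have h := C.act_assoc (FormalSum.point r + FormalSum.point s)
  rw [_root_.map_add, _root_.map_add, FormalSum.map_point, FormalSum.map_point,
    FormalSum.join_point, FormalSum.join_point] at h
  exact h.symm

theorem act_neg (C : Contramodule R) (r : FormalSum R C.carrier) : C.act (-r) = -C.act r := by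
  have h := C.act_assoc (-FormalSum.point r)
  rw [_root_.map_neg, _root_.map_neg, FormalSum.map_point, FormalSum.join_point] at h
  exact h.symm

theorem act_surjective (C : Contramodule R) : Function.Surjective C.act :=
  fun c => ⟨FormalSum.point c, C.act_point c⟩

/-- The underlying abelian group structure of a left contramodule. -/
noncomputable instance (C : Contramodule R) : AddCommGroup C.carrier where
  add_assoc a b c := by
    obtain ⟨r, rfl⟩ := C.act_surjective a
    obtain ⟨s, rfl⟩ := C.act_surjective b
    obtain ⟨t, rfl⟩ := C.act_surjective c
    rw [← act_add, ← act_add, ← act_add, ← act_add, add_assoc]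
  zero_add a := by
    obtain ⟨r, rfl⟩ := C.act_surjective a
    change C.act 0 + _ = _
    rw [← act_add, zero_add]
  add_zero a := by
    obtain ⟨r, rfl⟩ := C.act_surjective a
    change _ + C.act 0 = _
    rw [← act_add, add_zero]
  neg_add_cancel a := by
    obtain ⟨r, rfl⟩ := C.act_surjective a
    rw [← act_neg, ← act_add, neg_add_cancel]
    rfl
  add_comm a b := by
    obtain ⟨r, rfl⟩ := C.act_surjective a
    obtain ⟨s, rfl⟩ := C.act_surjective b
    rw [← act_add, ← act_add, add_comm]
  nsmul := nsmulRec
  zsmul := zsmulRec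

end Contramodule

end Contramodules

/-! ### Discrete right modules and the contratensor product -/

/-- A right `R`-module `N` (a module over `Rᵐᵒᵖ`) is discrete if the annihilator in `R` of each of
its elements is open. -/
class IsDiscreteRightModule (R : Type u) [Ring R] [TopologicalSpace R] (N : Type v)
    [AddCommGroup N] [Module Rᵐᵒᵖ N] : Prop where
  isOpen_annihilator : ∀ b : N, IsOpen {r : R | MulOpposite.op r • b = 0}

section Contratensor

variable {R : Type u} [Ring R] [UniformSpace R] [IsUniformAddGroup R] [IsTopologicalRing R]
  [CompleteSpace R] [T2Space R] [IsLinearTopology Rᵐᵒᵖ R]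

/-- For an element `b` of a discrete right `R`-module `N` and `r = ∑ rₓ x` in `R[[X]]`, the finite
formal linear combination `∑ (b rₓ) x` in `N[X]`. -/
noncomputable def FormalSum.smulLeft {N : Type v} [AddCommGroup N] [Module Rᵐᵒᵖ N]
    [IsDiscreteRightModule R N] {X : Type w} (b : N) (r : FormalSum R X) : X →₀ N :=
  Finsupp.ofSupportFinite (fun x => MulOpposite.op (r.1 x) • b) <|
    (show Tendsto r.1 cofinite (𝓝 0) from r.2)
      ((IsDiscreteRightModule.isOpen_annihilator (R := R) b).mem_nhds (by simp))

namespace Contratensor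

/-- The image of the difference of the two homomorphisms `N ⊗ R[[C]] ⇉ N ⊗ C` defining the
contratensor product: it is generated by the differences of the images of the pure tensors
`b ⊗ r`, namely `b ⊗ π(r)` and `∑_c (b r_c) ⊗ c` for `r = ∑_c r_c c`. -/
noncomputable def relations (N : Type v) [AddCommGroup N] [Module Rᵐᵒᵖ N]
    [IsDiscreteRightModule R N] (C : Contramodule R) : AddSubgroup (N ⊗[ℤ] C.carrier) :=
  AddSubgroup.closure (Set.range fun p : N × FormalSum R C.carrier =>
    p.1 ⊗ₜ[ℤ] C.act p.2 - (FormalSum.smulLeft p.1 p.2).sum fun c n => n ⊗ₜ[ℤ] c)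

end Contratensor

/-- The contratensor product of a discrete right `R`-module `N` and a left `R`-contramodule `C`:
the cokernel of the difference of the natural pair of homomorphisms `N ⊗ R[[C]] ⇉ N ⊗ C`. -/
abbrev Contratensor (N : Type v) [AddCommGroup N] [Module Rᵐᵒᵖ N]
    [IsDiscreteRightModule R N] (C : Contramodule R) : Type (max u v) :=
  (N ⊗[ℤ] C.carrier) ⧸ Contratensor.relations N C

/-- The homomorphism of contratensor products induced by a homomorphism of discrete right
`R`-modules. -/
noncomputable def Contratensor.map {N : Type v} [AddCommGroup N] [Module Rᵐᵒᵖ N]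
    [IsDiscreteRightModule R N] {N' : Type w} [AddCommGroup N'] [Module Rᵐᵒᵖ N']
    [IsDiscreteRightModule R N'] (f : N →ₗ[Rᵐᵒᵖ] N') (C : Contramodule R) :
    Contratensor N C →+ Contratensor N' C :=
  QuotientAddGroup.map (Contratensor.relations N C) (Contratensor.relations N' C)
    (TensorProduct.map f.toAddMonoidHom.toIntLinearMap
      (LinearMap.id : C.carrier →ₗ[ℤ] C.carrier)).toAddMonoidHom <| by
    rw [Contratensor.relations, AddSubgroup.closure_le]
    rintro _ ⟨⟨b, r⟩, rfl⟩
    refine AddSubgroup.subset_closure ⟨(f b, r), ?_⟩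
    have h : FormalSum.smulLeft (f b) r
        = (FormalSum.smulLeft b r).mapRange f (_root_.map_zero f) := by
      ext x
      exact (f.map_smul _ _).symm
    simp only [h, LinearMap.toAddMonoidHom_coe, _root_.map_sub, TensorProduct.map_tmul]
    rw [Finsupp.sum_mapRange_index (by simp), Finsupp.sum, Finsupp.sum, _root_.map_sum]
    rfl

/-- A left `R`-contramodule `F` is flat if the functor of contratensor product with `F` is exact
on the abelian category of discrete right `R`-modules. -/
def Contramodule.Flat (F : Contramodule R) : Prop :=
  ∀ (N₁ N₂ N₃ : Type u) [AddCommGroup N₁] [AddCommGroup N₂] [AddCommGroup N₃]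
    [Module Rᵐᵒᵖ N₁] [Module Rᵐᵒᵖ N₂] [Module Rᵐᵒᵖ N₃]
    [IsDiscreteRightModule R N₁] [IsDiscreteRightModule R N₂] [IsDiscreteRightModule R N₃]
    (f : N₁ →ₗ[Rᵐᵒᵖ] N₂) (g : N₂ →ₗ[Rᵐᵒᵖ] N₃),
    Function.Injective f → Function.Exact f g → Function.Surjective g →
      Function.Injective (Contratensor.map f F) ∧
      Function.Exact (Contratensor.map f F) (Contratensor.map g F) ∧
      Function.Surjective (Contratensor.map g F)

end Contratensor

/-! ### Conditions on an ideal -/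

/-- An ideal `H` of a (complete, separated) topological ring is strongly closed if it is closed, the
topological quotient group `R ⧸ H` is complete, and for every set `X` the induced map
`R[[X]] → (R ⧸ H)[[X]]` is surjective. -/
structure IsStronglyClosed {R : Type u} [Ring R] [TopologicalSpace R] [IsTopologicalRing R]
    (H : Ideal R) : Prop where
  isClosed : IsClosed (H : Set R)
  complete : @CompleteSpace (R ⧸ H) (IsTopologicalAddGroup.rightUniformSpace (R ⧸ H))
  surjective : ∀ X : Type u, Function.Surjective
    (FormalSum.mapCoeff (A := R) (B := R ⧸ H) H.mkQ.toAddMonoidHom H.continuous_mkQ X)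

/-- An ideal `H` is topologically left T-nilpotent if for any sequence `a₀, a₁, a₂, …` in `H` the
sequence of products `a₀, a₀ a₁, a₀ a₁ a₂, …` converges to zero. -/
def IsTopLeftTNilpotent {R : Type u} [Ring R] [TopologicalSpace R] (H : Ideal R) : Prop :=
  ∀ a : ℕ → R, (∀ n, a n ∈ H) →
    Tendsto (fun n => ((List.range (n + 1)).map a).prod) atTop (𝓝 0)

/-! ### Kleisli calculus of zero-convergent formal sums. -/

namespace FormalSum

variable {R : Type u} [Ring R] [UniformSpace R] [IsUniformAddGroup R] [IsTopologicalRing R]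
  [CompleteSpace R] [T2Space R] [IsLinearTopology Rᵐᵒᵖ R] {X Y Z : Type u}

/-! The flat contramodule F is shown to be a retract of a free one by building a projective cover
and using flatness to see that it is injective. Let K_γ be the kernel of R → S_γ, so that H is the
intersection of the K_γ. Each F/K_γF is a module over the semisimple ring R/K_γ, hence a direct sum
of left ideals generated by idempotents. T-nilpotency lifts these idempotents to idempotents e_x of
R (`exists_isIdempotentElem_sub_mem`), and the generators lift to elements f_x = e_x f_x of F, with
coordinate functions φ_x from F to R that are additive and compatible with the contraaction modulo H
(`CoordinateSystem`). Let P be the set of r in R[[X]] with r_x e_x = r_x for all x; the claim is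
that r ↦ ∑ r_x f_x maps P bijectively onto F.

Surjectivity. Since zero-convergent families lift from R/H, the coordinates of any c form, modulo H,
a formal sum, and c agrees with the corresponding combination of the f_x modulo every K_γF, hence
modulo HF. The contramodule Nakayama lemma removes HF. It rests on inverting 1 - s for an infinite
matrix s over H; the geometric series converges because T-nilpotency controls each path of matrix
entries and König's lemma makes this uniform.

Injectivity (`CoordinateSystem.eq_zero_of_lin_eq_zero`). Given a nonzero r in P with ∑ r_x f_x = 0,
take an open right ideal J maximal among those missing some coefficient of r. T-nilpotency gives R/J
a nonzero submodule M killed by H, and maximality forces all the classes of the r_x into M. By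
flatness the relation ∑ r_x ⊗ f_x = 0 over R/J already holds over M, where φ_x is a well-defined
functional, so the class of r_x e_x = r_x is zero for every x: a contradiction.

The inverse bijection is then compatible with the contraaction by uniqueness, and F is projective.
-/

theorem summable (r : FormalSum R X) : Summable r.1 :=
  summable_of_tendsto r.2

theorem ext_apply {r s : FormalSum R X} (h : ∀ x, r.1 x = s.1 x) : r = s :=
  Subtype.ext (funext h)

/-- A convergent sum differs from a finite partial sum by an element of any open subgroup
containing all the remaining terms. -/
theorem tsum_sub_sum_mem {X : Type*} {a : X → R} (ha : Tendsto a cofinite (𝓝 0)) (V : AddSubgroup R)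
    (hV : IsOpen (V : Set R)) (T : Finset X) (h : ∀ x ∉ T, a x ∈ V) :
    ∑' x, a x - ∑ x ∈ T, a x ∈ V := by
  classical
  have hs : HasSum a (∑' x, a x) := (summable_of_tendsto ha).hasSum
  have hc : IsClosed (V : Set R) := V.isClosed_of_isOpen hV
  have ht : Tendsto (fun S : Finset X => ∑ x ∈ S, a x - ∑ x ∈ T, a x) atTop
      (𝓝 (∑' x, a x - ∑ x ∈ T, a x)) := Tendsto.sub_const hs _
  refine hc.mem_of_tendsto ht ?_
  filter_upwards [eventually_ge_atTop T] with S hS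
  have hS' : T ⊆ S := hS
  rw [← Finset.sum_sdiff hS', add_sub_cancel_right]
  exact V.sum_mem fun x hx => h x (Finset.mem_sdiff.1 hx).2

theorem finite_notMem (r : FormalSum R X) {V : Set R} (hV : V ∈ 𝓝 0) :
    {x | r.1 x ∉ V}.Finite :=
  (show Tendsto r.1 cofinite (𝓝 0) from r.2) hV

/-- Modulo an open right ideal I, every row with r_x in I disappears, and each of the finitely many
other rows has finitely many terms. This double convergence justifies exchanging the sums in
`bind_bind`. -/
theorem tendsto_mul_prod (r : FormalSum R X) (G : X → FormalSum R Y) :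
    Tendsto (fun p : X × Y => r.1 p.1 * (G p.1).1 p.2) cofinite (𝓝 0) := by
  refine tendsto_of_rightIdeals fun I hI => ?_
  have hfin : ∀ x : X, {y | r.1 x * (G x).1 y ∉ I}.Finite := fun x => by
    refine finite_of_tendsto ?_ I hI
    have h := Tendsto.const_mul (r.1 x) (show Tendsto (G x).1 cofinite (𝓝 0) from (G x).2)
    rwa [mul_zero] at h
  refine ((finite_of_tendsto r.2 I hI).biUnion fun x _ =>
    (hfin x).image (Prod.mk x)).subset fun p hp => ?_
  simp only [Set.mem_iUnion]
  refine ⟨p.1, fun h => hp ?_, p.2, hp, rfl⟩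
  exact I.smul_mem (MulOpposite.op ((G p.1).1 p.2)) h

/-- The Kleisli extension `∑ rₓ x ↦ ∑ rₓ G(x)` of a map `G : X → R[[Y]]`. -/
noncomputable def bind (G : X → FormalSum R Y) : FormalSum R X →+ FormalSum R Y :=
  join.comp (map G)

theorem tendsto_bind (G : X → FormalSum R Y) (r : FormalSum R X) (y : Y) :
    Tendsto (fun x => r.1 x * (G x).1 y) cofinite (𝓝 0) :=
  IsLinearTopology.tendsto_mul_zero_of_left r.1 (fun x => (G x).1 y) r.2

/-- The monad operations first collect terms along the fibres of G; regrouping the sum over these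
fibres gives the ordinary row-times-matrix formula. -/
theorem bind_apply (G : X → FormalSum R Y) (r : FormalSum R X) (y : Y) :
    (bind G r).1 y = ∑' x, r.1 x * (G x).1 y := by
  have hs := summable_of_tendsto (tendsto_bind G r y)
  change ∑' s : FormalSum R Y, (∑' x : G ⁻¹' {s}, r.1 x) * s.1 y = _
  rw [← (Equiv.sigmaFiberEquiv G).tsum_eq]
  have hs' := ((Equiv.sigmaFiberEquiv G).summable_iff).2 hs
  refine Eq.trans ?_ hs'.tsum_sigma.symm
  refine tsum_congr fun s => ?_
  rw [← (summable_of_tendsto (tendsto_fiber r (G ⁻¹' {s}))).tsum_mul_right]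
  refine tsum_congr fun x => ?_
  obtain ⟨x, rfl⟩ := x
  rfl

theorem map_eq_bind (f : X → Y) (r : FormalSum R X) :
    map f r = bind (fun x => point (f x)) r := by
  classical
  refine ext_apply fun y => ?_
  rw [bind_apply]
  change ∑' x : f ⁻¹' {y}, r.1 x = _
  rw [tsum_subtype (f ⁻¹' {y}) r.1]
  refine tsum_congr fun x => ?_
  by_cases h : f x = y
  · rw [Set.indicator_of_mem (by exact h), ← h, point_self, mul_one]
  · rw [Set.indicator_of_notMem (by exact h), point_of_ne (Ne.symm h), mul_zero]

theorem bind_bind (G : X → FormalSum R Y) (K : Y → FormalSum R Z) (r : FormalSum R X) :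
    bind K (bind G r) = bind (fun x => bind K (G x)) r := by
  refine ext_apply fun z => ?_
  simp only [bind_apply]
  have h1 : ∀ y, (∑' x, r.1 x * (G x).1 y) * (K y).1 z =
      ∑' x, r.1 x * (G x).1 y * (K y).1 z := fun y =>
    ((summable_of_tendsto (tendsto_bind G r y)).tsum_mul_right _).symm
  have h2 : ∀ x, r.1 x * (∑' y, (G x).1 y * (K y).1 z) =
      ∑' y, r.1 x * (G x).1 y * (K y).1 z := fun x => by
    rw [← (summable_of_tendsto (tendsto_bind K (G x) z)).tsum_mul_left]
    exact tsum_congr fun y => (mul_assoc _ _ _).symm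
  rw [tsum_congr h1, tsum_congr h2]
  have h3 : Summable (Function.uncurry fun x y => r.1 x * (G x).1 y * (K y).1 z) :=
    summable_of_tendsto (IsLinearTopology.tendsto_mul_zero_of_left
      (fun p : X × Y => r.1 p.1 * (G p.1).1 p.2) (fun p => (K p.2).1 z) (tendsto_mul_prod r G))
  exact h3.tsum_comm

theorem map_bind (f : Y → Z) (G : X → FormalSum R Y) (r : FormalSum R X) :
    map f (bind G r) = bind (fun x => map f (G x)) r := by
  simp only [map_eq_bind, bind_bind]

theorem bind_add_left (G K : X → FormalSum R Y) (r : FormalSum R X) :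
    bind (G + K) r = bind G r + bind K r := by
  refine ext_apply fun y => ?_
  change _ = (bind G r).1 y + (bind K r).1 y
  rw [bind_apply, bind_apply, bind_apply,
    ← (summable_of_tendsto (tendsto_bind G r y)).tsum_add
      (summable_of_tendsto (tendsto_bind K r y))]
  exact tsum_congr fun x => mul_add _ _ _

/-- The formal linear combination with the single coefficient `a` at `x`. -/
noncomputable def single (a : R) (x : X) : FormalSum R X :=
  ⟨fun z => a * (point x : FormalSum R X).1 z, by
    have h := Tendsto.const_mul a
      (show Tendsto (point x : FormalSum R X).1 cofinite (𝓝 0) from (point x).2)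
    rwa [mul_zero] at h⟩

theorem single_self (a : R) (x : X) : (single a x).1 x = a := by
  change a * _ = a
  rw [point_self, mul_one]

theorem single_of_ne (a : R) {x z : X} (h : z ≠ x) : (single a x).1 z = 0 := by
  change a * _ = 0
  rw [point_of_ne h, mul_zero]

theorem single_one (x : X) : single (1 : R) x = point x :=
  ext_apply fun _ => one_mul _

theorem single_add (a b : R) (x : X) : single (a + b) x = single a x + single b x :=
  ext_apply fun _ => add_mul _ _ _

theorem single_mem {V : AddSubgroup R} {a : R} (ha : a ∈ V) (x z : X) :
    (single a x).1 z ∈ V := by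
  by_cases h : z = x
  · rw [h, single_self]; exact ha
  · rw [single_of_ne a h]; exact V.zero_mem

theorem bind_single_apply (G : X → FormalSum R Y) (a : R) (x : X) (y : Y) :
    (bind G (single a x)).1 y = a * (G x).1 y := by
  rw [bind_apply, tsum_eq_single x, single_self]
  intro z hz
  rw [single_of_ne a hz, zero_mul]

theorem map_single (f : X → Y) (a : R) (x : X) : map f (single a x) = single a (f x) := by
  refine ext_apply fun y => ?_
  rw [map_eq_bind, bind_single_apply]
  rfl

/-- Multiplication of the coefficients on the right by a family of elements of the ring. -/
noncomputable def mulRight (a : X → R) : FormalSum R X →+ FormalSum R X :=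
  bind fun x => single (a x) x

theorem mulRight_apply (a : X → R) (r : FormalSum R X) (x : X) :
    (mulRight a r).1 x = r.1 x * a x := by
  rw [mulRight, bind_apply, tsum_eq_single x, single_self]
  intro z hz
  rw [single_of_ne _ hz.symm, mul_zero]

/-- If all coefficients of `r` outside a finite set `T` lie in `V`, then so do all coefficients of
the difference of `r` and its restriction to `T`. -/
theorem sub_sum_single_mem (r : FormalSum R X) (V : AddSubgroup R) (T : Finset X)
    (h : ∀ x ∉ T, r.1 x ∈ V) (z : X) : (r - ∑ x ∈ T, single (r.1 x) x).1 z ∈ V := by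
  have key : (∑ x ∈ T, single (r.1 x) x).1 z = ∑ x ∈ T, (single (r.1 x) x).1 z := by
    rw [AddSubgroup.val_finsetSum, Finset.sum_apply]
  change r.1 z - (∑ x ∈ T, single (r.1 x) x).1 z ∈ V
  rw [key]
  by_cases hz : z ∈ T
  · rw [Finset.sum_eq_single_of_mem z hz fun x _ hx => single_of_ne _ hx.symm, single_self,
      sub_self]
    exact V.zero_mem
  · rw [Finset.sum_eq_zero fun x hx => single_of_ne _ fun e => hz (by rwa [e]), sub_zero]
    exact h z hz

theorem map_mem {V : AddSubgroup R} (hV : IsClosed (V : Set R)) (f : X → Y) {r : FormalSum R X}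
    (hr : ∀ x, r.1 x ∈ V) (y : Y) : (map f r).1 y ∈ V :=
  tsum_mem hV fun x : f ⁻¹' {y} => hr x

theorem bind_mem {V : AddSubgroup R} (hV : IsClosed (V : Set R)) (G : X → FormalSum R Y)
    {r : FormalSum R X} (y : Y) (h : ∀ x, r.1 x * (G x).1 y ∈ V) : (bind G r).1 y ∈ V := by
  rw [bind_apply]
  exact tsum_mem hV h

end FormalSum

/-! ### Infinite linear combinations in a contramodule. -/

namespace Contramodule

variable {R : Type u} [Ring R] [UniformSpace R] [IsUniformAddGroup R] [IsTopologicalRing R]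
  [CompleteSpace R] [T2Space R] [IsLinearTopology Rᵐᵒᵖ R] {X Y : Type u}

open FormalSum

/-- The infinite linear combination `∑ rₓ f(x)` in a contramodule. -/
noncomputable def lin {C : Contramodule R} (f : X → C.carrier) : FormalSum R X →+ C.carrier where
  toFun r := C.act (FormalSum.map f r)
  map_zero' := by rw [map_zero]; rfl
  map_add' r s := by rw [map_add, act_add]

variable {C D : Contramodule R}

theorem lin_apply (f : X → C.carrier) (r : FormalSum R X) :
    lin f r = C.act (FormalSum.map f r) := rfl

theorem lin_id (r : FormalSum R C.carrier) : lin id r = C.act r := by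
  rw [lin_apply, FormalSum.map_id]

theorem lin_point (f : X → C.carrier) (x : X) : lin f (point x) = f x := by
  rw [lin_apply, map_point, act_point]

theorem lin_map (f : Y → C.carrier) (g : X → Y) (r : FormalSum R X) :
    lin f (FormalSum.map g r) = lin (f ∘ g) r := by
  rw [lin_apply, lin_apply, FormalSum.map_comp]

/-- Contraassociativity in Kleisli form; with it, computations in a contramodule become matrix
computations. -/
theorem lin_bind (f : Y → C.carrier) (G : X → FormalSum R Y) (r : FormalSum R X) :
    lin f (bind G r) = lin (fun x => lin f (G x)) r := by
  rw [lin_apply, FormalSum.map_bind, FormalSum.bind, AddMonoidHom.comp_apply, ← C.act_assoc, ← FormalSum.map_comp]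
  rfl

theorem lin_add_left (f g : X → C.carrier) (r : FormalSum R X) :
    lin (f + g) r = lin f r + lin g r := by
  have h := lin_bind id ((fun x => point (f x)) + fun x => point (g x)) r
  rw [bind_add_left, ← map_eq_bind, ← map_eq_bind, map_add, lin_id, lin_id] at h
  rw [lin_apply f, lin_apply g, h]
  congr 2
  funext x
  rw [Pi.add_apply, Pi.add_apply, map_add, lin_point, lin_point]
  rfl

/-- `lin f r` as a homomorphism in `f`. -/
noncomputable def linHom (r : FormalSum R X) : (X → C.carrier) →+ C.carrier :=
  AddMonoidHom.mk' (fun f => lin f r) fun f g => lin_add_left f g r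

theorem lin_sub_left (f g : X → C.carrier) (r : FormalSum R X) :
    lin (f - g) r = lin f r - lin g r :=
  (linHom r).map_sub f g

theorem hom_lin (h : C ⟶ D) (f : X → C.carrier) (r : FormalSum R X) :
    h.toFun (lin f r) = lin (h.toFun ∘ f) r := by
  rw [lin_apply, h.map_act, ← FormalSum.map_comp]
  rfl

/-- The underlying left module structure of a left contramodule. -/
noncomputable instance (C : Contramodule R) : Module R C.carrier where
  smul a c := C.act (single a c)
  one_smul c := by
    change C.act (single 1 c) = c
    rw [single_one, act_point]
  mul_smul a b c := by
    change C.act (single (a * b) c) = C.act (single a (C.act (single b c)))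
    have h := lin_bind (C := C) id (fun c => single b c) (single a c)
    rw [lin_id, lin_apply, map_single, lin_id] at h
    rw [← h]
    congr 1
    refine ext_apply fun y => ?_
    rw [bind_single_apply]
    exact mul_assoc _ _ _
  smul_zero a := by
    -- Scalar multiplication by a is a linear combination over a one-point index set, so its
    -- additivity is that of `linHom`.
    have h := (linHom (C := C) (single a PUnit.unit)).map_zero
    change C.act _ = _ at h
    rwa [map_single] at h
  smul_add a c d := by
    have h := (linHom (C := C) (single a PUnit.unit)).map_add (fun _ => c) (fun _ => d)
    change C.act _ = C.act _ + C.act _ at h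
    rwa [map_single, map_single, map_single] at h
  add_smul a b c := by
    change C.act (single (a + b) c) = _
    rw [single_add, act_add]
    rfl
  zero_smul c := by
    change C.act (single 0 c) = C.act 0
    congr 1
    exact ext_apply fun _ => zero_mul _

theorem act_single (a : R) (c : C.carrier) : C.act (single a c) = a • c := rfl

theorem lin_single (f : X → C.carrier) (a : R) (x : X) : lin f (single a x) = a • f x := by
  rw [lin_apply, map_single, act_single]

theorem lin_mulRight (f : X → C.carrier) (a : X → R) (r : FormalSum R X) :
    lin f (mulRight a r) = lin (fun x => a x • f x) r := by
  rw [mulRight, lin_bind]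
  simp only [lin_single]

theorem lin_const (c : C.carrier) (r : FormalSum R X) :
    lin (fun _ => c) r = (∑' x, r.1 x) • c := by
  rw [lin_apply, ← act_single]
  congr 1
  refine ext_apply fun y => ?_
  rw [map_eq_bind, bind_apply]
  exact (summable r).tsum_mul_right _

/-- The submodule `K C` of all infinite linear combinations of elements of a contramodule `C` with
coefficients in an ideal `K`. -/
def idealSpan (K : Ideal R) (C : Contramodule R) : Submodule R C.carrier where
  carrier := {c | ∃ r : FormalSum R C.carrier, (∀ x, r.1 x ∈ K) ∧ C.act r = c}
  zero_mem' := ⟨0, fun _ => K.zero_mem, rfl⟩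
  add_mem' := by
    rintro _ _ ⟨r, hr, rfl⟩ ⟨s, hs, rfl⟩
    exact ⟨r + s, fun x => K.add_mem (hr x) (hs x), act_add _ _ _⟩
  smul_mem' := by
    rintro a _ ⟨r, hr, rfl⟩
    refine ⟨FormalSum.bind (fun _ => r) (single a PUnit.unit), fun x => ?_, ?_⟩
    · rw [bind_single_apply]
      exact K.mul_mem_left a (hr x)
    · rw [← lin_id, lin_bind, lin_single, lin_id]

theorem lin_mem_idealSpan {K : Ideal R} (hK : IsClosed (K : Set R)) (f : X → C.carrier)
    {r : FormalSum R X} (hr : ∀ x, r.1 x ∈ K) : lin f r ∈ idealSpan K C :=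
  ⟨_, map_mem (V := K.toAddSubgroup) hK f hr, rfl⟩

theorem smul_mem_idealSpan {K : Ideal R} {a : R} (ha : a ∈ K) (c : C.carrier) :
    a • c ∈ idealSpan K C :=
  ⟨_, single_mem (V := K.toAddSubgroup) ha c, rfl⟩

/-- Modulo an open ideal an infinite linear combination reduces to a finite one. -/
theorem lin_sub_sum_mem_idealSpan {K : Ideal R} (hK : IsOpen (K : Set R)) (f : X → C.carrier)
    (r : FormalSum R X) (T : Finset X) (hT : ∀ x ∉ T, r.1 x ∈ K) :
    lin f r - ∑ x ∈ T, r.1 x • f x ∈ idealSpan K C := by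
  have h := lin_mem_idealSpan (K.toAddSubgroup.isClosed_of_isOpen hK) f
    (sub_sum_single_mem r K.toAddSubgroup T hT)
  simpa only [map_sub, map_sum, lin_single] using h

end Contramodule

/-! ### Inverting 1 - s for an infinite matrix over a T-nilpotent ideal. -/

namespace FormalSum

variable {R : Type u} [Ring R] [UniformSpace R] [IsUniformAddGroup R] [IsTopologicalRing R]
  [CompleteSpace R] [T2Space R] [IsLinearTopology Rᵐᵒᵖ R] {X Y : Type u}

theorem eq_zero_of_forall_mem {a : R}
    (h : ∀ I : Submodule Rᵐᵒᵖ R, IsOpen (I : Set R) → a ∈ I) : a = 0 := by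
  by_contra ha
  obtain ⟨I, hI, hIa⟩ := (IsLinearTopology.hasBasis_open_submodule (M := R) Rᵐᵒᵖ).mem_iff.1
    (isOpen_compl_singleton.mem_nhds (show (0 : R) ∈ ({a}ᶜ : Set R) from fun e => ha e.symm))
  exact hIa (h I hI) rfl

/-- The subgroup of `R[[X]]` of formal linear combinations with coefficients in `V`. -/
def coeffIn (V : AddSubgroup R) (X : Type u) : AddSubgroup (FormalSum R X) where
  carrier := {r | ∀ x, r.1 x ∈ V}
  zero_mem' _ := V.zero_mem
  add_mem' hr hs x := V.add_mem (hr x) (hs x)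
  neg_mem' hr x := V.neg_mem (hr x)

/-- Matrices act by multiplying coefficients on the right, which is why right ideals are preserved.
-/
theorem bind_mem_coeffIn {I : Submodule Rᵐᵒᵖ R} (hI : IsOpen (I : Set R))
    (G : X → FormalSum R Y) {r : FormalSum R X} (hr : r ∈ coeffIn I.toAddSubgroup X) :
    bind G r ∈ coeffIn I.toAddSubgroup Y := fun y =>
  bind_mem (V := I.toAddSubgroup) (I.toAddSubgroup.isClosed_of_isOpen hI) G y fun x =>
    I.smul_mem (MulOpposite.op ((G x).1 y)) (hr x)

section GeometricSeries

variable {s : X → FormalSum R X} {I : Submodule Rᵐᵒᵖ R}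

/-- All but finitely many coefficients of all the iterates of `v` lie in `I`. -/
def IteratesVanish (s : X → FormalSum R X) (I : Submodule Rᵐᵒᵖ R) (v : FormalSum R X) : Prop :=
  {p : ℕ × X | ((bind s)^[p.1] v).1 p.2 ∉ I}.Finite

theorem IteratesVanish.add {v w : FormalSum R X} (hv : IteratesVanish s I v)
    (hw : IteratesVanish s I w) : IteratesVanish s I (v + w) := by
  refine (hv.union hw).subset fun p hp => ?_
  by_contra hc
  simp only [Set.mem_union, not_or, Set.mem_ofPred_eq, not_not] at hc
  refine hp ?_
  rw [iterate_map_add]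
  exact I.add_mem hc.1 hc.2

theorem IteratesVanish.sum {ι : Type*} (T : Finset ι) {v : ι → FormalSum R X}
    (h : ∀ i ∈ T, IteratesVanish s I (v i)) : IteratesVanish s I (∑ i ∈ T, v i) := by
  classical
  induction T using Finset.induction_on with
  | empty =>
    rw [Finset.sum_empty]
    refine Set.finite_empty.subset fun p hp => hp ?_
    rw [iterate_map_zero]
    exact I.zero_mem
  | insert i T hi ih =>
    rw [Finset.sum_insert hi]
    exact (h i (Finset.mem_insert_self i T)).add
      (ih fun j hj => h j (Finset.mem_insert_of_mem hj))

theorem iterate_bind_mem_coeffIn (hI : IsOpen (I : Set R)) {v : FormalSum R X}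
    (hv : v ∈ coeffIn I.toAddSubgroup X) (n : ℕ) :
    (bind s)^[n] v ∈ coeffIn I.toAddSubgroup X := by
  induction n with
  | zero => exact hv
  | succ n ih =>
    rw [Function.iterate_succ_apply']
    exact bind_mem_coeffIn hI s ih

theorem iteratesVanish_of_mem (hI : IsOpen (I : Set R)) {v : FormalSum R X}
    (hv : v ∈ coeffIn I.toAddSubgroup X) : IteratesVanish s I v :=
  Set.finite_empty.subset fun p hp => hp (iterate_bind_mem_coeffIn hI hv p.1 p.2)

theorem iteratesVanish_of_bind (hI : IsOpen (I : Set R)) {v : FormalSum R X}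
    (hv : IteratesVanish s I (bind s v)) : IteratesVanish s I v := by
  refine ((hv.image fun p => (p.1 + 1, p.2)).union
    ((finite_of_tendsto v.2 I hI).image fun x => (0, x))).subset ?_
  rintro ⟨n, x⟩ hp
  cases n with
  | zero => exact Or.inr ⟨x, hp, rfl⟩
  | succ n => exact Or.inl ⟨(n, x), hp, rfl⟩

/-- The branching step of König's lemma: one application of s turns a·x into finitely many monomials
plus a remainder with coefficients in I. The remainder is harmless, so a bad monomial has a bad
successor. -/
theorem exists_not_iteratesVanish (hI : IsOpen (I : Set R)) {a : R} {x : X}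
    (h : ¬ IteratesVanish s I (single a x)) :
    ∃ y, ¬ IteratesVanish s I (single (a * (s x).1 y) y) := by
  by_contra! hc
  refine h (iteratesVanish_of_bind hI ?_)
  have hfin := finite_of_tendsto (bind s (single a x)).2 I hI
  have hmem := sub_sum_single_mem (bind s (single a x)) I.toAddSubgroup hfin.toFinset
    fun y hy => by
      by_contra hy'
      exact hy (hfin.mem_toFinset.2 hy')
  rw [← sub_add_cancel (bind s (single a x))
    (∑ y ∈ hfin.toFinset, single ((bind s (single a x)).1 y) y)]
  refine (iteratesVanish_of_mem hI hmem).add (IteratesVanish.sum _ fun y _ => ?_)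
  rw [bind_single_apply]
  exact hc y

/-- König's lemma: a failure propagates along an infinite path whose coefficients are the products
of the successive matrix entries. T-nilpotency puts such a product in I, after which nothing can
fail. -/
theorem iteratesVanish_point {H : Ideal R} (hT : IsTopLeftTNilpotent H)
    (hs : ∀ x y, (s x).1 y ∈ H) (hI : IsOpen (I : Set R)) (x : X) :
    IteratesVanish s I (point x) := by
  rw [← single_one]
  by_contra h
  choose next hnext using fun p : {p : R × X // ¬ IteratesVanish s I (single p.1 p.2)} =>
    exists_not_iteratesVanish hI p.2
  let step : {p : R × X // ¬ IteratesVanish s I (single p.1 p.2)} →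
      {p : R × X // ¬ IteratesVanish s I (single p.1 p.2)} :=
    fun p => ⟨(p.1.1 * (s p.1.2).1 (next p), next p), hnext p⟩
  let q : ℕ → {p : R × X // ¬ IteratesVanish s I (single p.1 p.2)} :=
    fun n => step^[n] ⟨(1, x), h⟩
  let b : ℕ → R := fun n => (s (q n).1.2).1 (next (q n))
  have hq : ∀ n, (q n).1.1 = ((List.range n).map b).prod := by
    intro n
    induction n with
    | zero => rfl
    | succ n ih =>
      rw [List.range_succ, List.map_append, List.prod_append, ← ih, List.map_singleton,
        List.prod_singleton]
      change (step^[n + 1] _).1.1 = _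
      rw [Function.iterate_succ_apply']
  have ht := hT b fun n => hs _ _
  obtain ⟨n, hn⟩ := (ht.eventually (hI.mem_nhds I.zero_mem)).exists
  -- The n-th product in the definition of T-nilpotency has n + 1 factors, hence the shift.
  refine (q (n + 1)).2 (iteratesVanish_of_mem hI fun y => ?_)
  exact single_mem (V := I.toAddSubgroup) (by rw [hq]; exact hn) _ _

/-- The geometric series: an infinite matrix with entries in a topologically left T-nilpotent ideal
can be subtracted from the identity and inverted. -/
theorem exists_eq_point_add_bind {H : Ideal R} (hT : IsTopLeftTNilpotent H)
    (hs : ∀ x y, (s x).1 y ∈ H) (x : X) : ∃ u : FormalSum R X, u = point x + bind s u := by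
  have hv : ∀ I : Submodule Rᵐᵒᵖ R, IsOpen (I : Set R) → IteratesVanish s I (point x) :=
    fun I hI => iteratesVanish_point hT hs hI x
  have htend : ∀ y, Tendsto (fun n => ((bind s)^[n] (point x)).1 y) cofinite (𝓝 0) := fun y =>
    tendsto_of_rightIdeals fun I hI =>
      ((hv I hI).image Prod.fst).subset fun n hn => ⟨(n, y), hn, rfl⟩
  let u : FormalSum R X := ⟨fun y => ∑' n, ((bind s)^[n] (point x)).1 y, by
    refine tendsto_of_rightIdeals fun I hI => ?_
    refine ((hv I hI).image Prod.snd).subset fun y hy => ?_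
    by_contra hc
    refine hy (tsum_mem_rightIdeal I hI fun n => ?_)
    by_contra hn
    exact hc ⟨(n, y), hn, rfl⟩⟩
  refine ⟨u, sub_eq_zero.1 (ext_apply fun y => eq_zero_of_forall_mem fun I hI => ?_)⟩
  obtain ⟨N, hN⟩ := ((hv I hI).image Prod.fst).bddAbove
  have hlarge : ∀ n, N < n → (bind s)^[n] (point x) ∈ coeffIn I.toAddSubgroup X := by
    intro n hn z
    by_contra hz
    exact absurd (hN ⟨(n, z), hz, rfl⟩) (not_le.2 hn)
  have hw : u - ∑ n ∈ Finset.range (N + 1), (bind s)^[n] (point x) ∈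
      coeffIn I.toAddSubgroup X := by
    intro z
    change u.1 z - (∑ n ∈ Finset.range (N + 1), (bind s)^[n] (point x)).1 z ∈ I.toAddSubgroup
    rw [AddSubgroup.val_finsetSum, Finset.sum_apply]
    refine tsum_sub_sum_mem (htend z) I.toAddSubgroup hI _ fun n hn => hlarge n ?_ z
    rw [Finset.mem_range, not_lt] at hn
    exact hn
  -- With w the tail of the series beyond N, the defect telescopes to w - ws - xs^(N+1), whose three
  -- terms all have coefficients in I.
  have key : u - (point x + bind s u) =
      (u - ∑ n ∈ Finset.range (N + 1), (bind s)^[n] (point x)) -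
      bind s (u - ∑ n ∈ Finset.range (N + 1), (bind s)^[n] (point x)) -
      (bind s)^[N + 1] (point x) := by
    have h1 : bind s (∑ n ∈ Finset.range (N + 1), (bind s)^[n] (point x)) + point x =
        ∑ n ∈ Finset.range (N + 1), (bind s)^[n] (point x) + (bind s)^[N + 1] (point x) := by
      rw [← Finset.sum_range_succ, Finset.sum_range_succ' _ (N + 1), map_sum]
      simp only [Function.iterate_succ_apply', Function.iterate_zero, id]
    have h2 := eq_sub_of_add_eq h1
    rw [map_sub, h2]
    abel
  rw [key]
  exact (coeffIn I.toAddSubgroup X).sub_mem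
    ((coeffIn I.toAddSubgroup X).sub_mem hw (bind_mem_coeffIn hI s hw))
    (hlarge _ (Nat.lt_succ_self N)) y

end GeometricSeries

end FormalSum

/-! ### Nakayama's lemma. -/

namespace Contramodule

variable {R : Type u} [Ring R] [UniformSpace R] [IsUniformAddGroup R] [IsTopologicalRing R]
  [CompleteSpace R] [T2Space R] [IsLinearTopology Rᵐᵒᵖ R]

open FormalSum

/-- The contramodule Nakayama lemma. -/
theorem mem_of_forall_exists_sub_mem_idealSpan {C : Contramodule R} {H : Ideal R}
    (hT : IsTopLeftTNilpotent H) (B : AddSubgroup C.carrier)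
    (hB : ∀ f : C.carrier → C.carrier, (∀ c, f c ∈ B) → ∀ r : FormalSum R C.carrier, lin f r ∈ B)
    (h : ∀ c : C.carrier, ∃ d ∈ idealSpan H C, c - d ∈ B) (c : C.carrier) : c ∈ B := by
  choose d hd hdB using h
  choose s hs hsd using hd
  -- Here u is the row of (1 - s)⁻¹ at c. The combination ∑ u_x (x - d x) lies in B, and it
  -- evaluates to u(1 - s), that is, to c.
  obtain ⟨u, hu⟩ := exists_eq_point_add_bind hT hs c
  have h1 := hB (id - d) hdB u
  have h2 : lin d u = lin id (FormalSum.bind s u) := by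
    rw [lin_bind]
    congr 2
    funext x
    rw [lin_id, hsd]
  rw [lin_sub_left, h2, ← map_sub, sub_eq_of_eq_add hu, lin_point] at h1
  exact h1

end Contramodule

/-! ### Lifting idempotents. -/

/-- Newton iteration for the equation `e ^ 2 = e`. -/
theorem exists_seq_dvd_sq_sub_self {A : Type*} [CommRing A] (x : A) :
    ∃ E : ℕ → A, E 0 = x ∧ (∀ n, (x ^ 2 - x) ^ (n + 1) ∣ E n ^ 2 - E n) ∧
      ∀ n, (x ^ 2 - x) ^ (n + 1) ∣ E (n + 1) - E n := by
  let E : ℕ → A := fun n => (fun p : A => 3 * p ^ 2 - 2 * p ^ 3)^[n] x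
  have hE : ∀ n, E (n + 1) = 3 * E n ^ 2 - 2 * E n ^ 3 := fun n =>
    Function.iterate_succ_apply' _ _ _
  have hdvd : ∀ n, (x ^ 2 - x) ^ (n + 1) ∣ E n ^ 2 - E n := by
    intro n
    induction n with
    | zero => rw [zero_add, pow_one]; exact dvd_rfl
    | succ n ih =>
      have h1 : E (n + 1) ^ 2 - E (n + 1) =
          (E n ^ 2 - E n) ^ 2 * (4 * E n ^ 2 - 4 * E n - 3) := by rw [hE]; ring
      have h2 := pow_dvd_pow_of_dvd ih 2
      rw [← pow_mul] at h2
      rw [h1]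
      -- The error is squared at each step; only n + 2 ≤ 2(n + 1) is needed.
      exact ((pow_dvd_pow _ (by omega)).trans h2).mul_right _
  refine ⟨E, rfl, hdvd, fun n => ?_⟩
  have h1 : E (n + 1) - E n = (E n ^ 2 - E n) * (1 - 2 * E n) := by rw [hE]; ring
  rw [h1]
  exact (hdvd n).mul_right _

/-- Newton iteration in ℤ[X], evaluated at a, has increments and errors in z^(n+1)R for z = a² - a.
The powers of z tend to zero by T-nilpotency of the constant sequence, so the iteration converges,
and closedness of H keeps the limit in a + H. -/
theorem exists_isIdempotentElem_sub_mem {R : Type u} [Ring R] [UniformSpace R]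
    [IsUniformAddGroup R] [IsTopologicalRing R] [CompleteSpace R] [T2Space R]
    [IsLinearTopology Rᵐᵒᵖ R] {H : Ideal R} [H.IsTwoSided] (hc : IsClosed (H : Set R))
    (hT : IsTopLeftTNilpotent H) {a : R} (ha : a * a - a ∈ H) :
    ∃ e : R, IsIdempotentElem e ∧ e - a ∈ H := by
  obtain ⟨E, h0, hd, hd'⟩ := exists_seq_dvd_sq_sub_self (Polynomial.X : Polynomial ℤ)
  choose q hq using hd
  choose q' hq' using hd'
  let ev : Polynomial ℤ →+* R := (Polynomial.aeval a).toRingHom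
  have hX : ev Polynomial.X = a := Polynomial.aeval_X a
  set z : R := a * a - a with hz
  have hpow : ∀ n, ev ((Polynomial.X ^ 2 - Polynomial.X) ^ n) = z ^ n := fun n => by
    rw [map_pow, map_sub, map_pow, hX, sq]
  have hnil : Tendsto (fun n => z ^ (n + 1)) atTop (𝓝 0) := by
    have := hT (fun _ => z) fun _ => ha
    simpa only [List.map_const', List.prod_replicate, List.length_range] using this
  have htend : ∀ b : ℕ → R, Tendsto (fun n => z ^ (n + 1) * b n) cofinite (𝓝 0) := fun b =>
    IsLinearTopology.tendsto_mul_zero_of_left (fun n => z ^ (n + 1)) b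
      (by rw [Nat.cofinite_eq_atTop]; exact hnil)
  have hdiff : ∀ n, ev (E (n + 1)) - ev (E n) = z ^ (n + 1) * ev (q' n) := fun n => by
    rw [← map_sub, hq', map_mul, hpow]
  have hidem : ∀ n, ev (E n) * ev (E n) - ev (E n) = z ^ (n + 1) * ev (q n) := fun n => by
    rw [← map_mul, ← map_sub, ← sq, hq, map_mul, hpow]
  have hmem : ∀ n (b : R), z ^ (n + 1) * b ∈ H := fun n b =>
    H.mul_mem_right b (by rw [pow_succ]; exact H.mul_mem_left _ ha)
  have hlim : Tendsto (fun n => ev (E n)) atTop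
      (𝓝 (∑' n, (ev (E (n + 1)) - ev (E n)) + a)) := by
    have hsum : Summable fun n => ev (E (n + 1)) - ev (E n) :=
      FormalSum.summable_of_tendsto (by simpa only [hdiff] using htend fun n => ev (q' n))
    have h1 := hsum.hasSum.tendsto_sum_nat.add_const a
    refine h1.congr fun n => ?_
    rw [Finset.sum_range_sub (fun n => ev (E n)), h0, hX, sub_add_cancel]
  refine ⟨_, sub_eq_zero.1 (tendsto_nhds_unique ((hlim.mul hlim).sub hlim) ?_), ?_⟩
  · have h1 := htend fun n => ev (q n)
    rw [Nat.cofinite_eq_atTop] at h1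
    exact h1.congr fun n => (hidem n).symm
  · rw [add_sub_cancel_right]
    refine tsum_mem (s := H.toAddSubgroup) hc fun n => ?_
    rw [hdiff]
    exact hmem n _

/-! ### Modules over semisimple rings in idempotent coordinates. -/

section Semisimple

variable {A : Type*} [Ring A] [IsSemisimpleRing A]

/-- The annihilator of a nonzero v is generated by an idempotent p, so L ≅ A/Ap ≅ A(1 - p), and e =
1 - p. -/
theorem IsSimpleModule.exists_idempotent_generator {L : Type*} [AddCommGroup L] [Module A L]
    [IsSimpleModule A L] : ∃ (v : L) (e : A) (ψ : L →ₗ[A] A),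
      IsIdempotentElem e ∧ e • v = v ∧ ψ v = e ∧ ∀ l, ψ l • v = l := by
  have := IsSimpleModule.nontrivial A L
  obtain ⟨v, hv⟩ := exists_ne (0 : L)
  have hsurj := IsSimpleModule.toSpanSingleton_surjective A hv
  obtain ⟨p, hp, hker⟩ := IsSemisimpleRing.ideal_eq_span_idempotent
    (LinearMap.ker (LinearMap.toSpanSingleton A L v))
  have hpv : p • v = 0 := by
    have : p ∈ LinearMap.ker (LinearMap.toSpanSingleton A L v) := by
      rw [hker]; exact Ideal.mem_span_singleton_self p
    exact this
  have hle : LinearMap.ker (LinearMap.toSpanSingleton A L v) ≤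
      LinearMap.ker (LinearMap.toSpanSingleton A A (1 - p)) := by
    rw [hker, Ideal.span_le, Set.singleton_subset_iff]
    exact hp.mul_one_sub_self
  let ψ : L →ₗ[A] A := (Submodule.liftQ _ _ hle).comp
    (LinearMap.quotKerEquivOfSurjective _ hsurj).symm.toLinearMap
  have hψ : ∀ s : A, ψ (s • v) = s * (1 - p) := fun s => by
    have h1 : (LinearMap.quotKerEquivOfSurjective _ hsurj).symm (s • v) =
        Submodule.Quotient.mk s := by
      rw [LinearEquiv.symm_apply_eq]
      rfl
    change Submodule.liftQ _ _ hle ((LinearMap.quotKerEquivOfSurjective _ hsurj).symm (s • v)) = _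
    rw [h1]
    rfl
  have hev : (1 - p) • v = v := by rw [sub_smul, hpv, one_smul, sub_zero]
  refine ⟨v, 1 - p, ψ, hp.one_sub, hev, ?_, fun l => ?_⟩
  · have := hψ 1
    rwa [one_smul, one_mul] at this
  · obtain ⟨s, rfl⟩ := hsurj l
    change ψ (s • v) • v = s • v
    rw [hψ, mul_smul, hev]

/-- A module over a semisimple ring is a direct sum of left ideals generated by idempotents. -/
theorem IsSemisimpleRing.exists_idempotent_coordinates (A : Type w) [Ring A] [IsSemisimpleRing A]
    (G : Type u) [AddCommGroup G] [Module A G] :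
    ∃ (Y : Type u) (v : Y → G) (e : Y → A) (φ : Y → G →ₗ[A] A),
      (∀ y, IsIdempotentElem (e y)) ∧ (∀ y, e y • v y = v y) ∧ (∀ y, φ y (v y) = e y) ∧
      (∀ y y', y ≠ y' → φ y (v y') = 0) ∧
      ∀ g, ∃ T : Finset Y, (∀ y ∉ T, φ y g = 0) ∧ g = ∑ y ∈ T, φ y g • v y := by
  classical
  obtain ⟨s, f, -, hs⟩ := IsSemisimpleModule.exists_linearEquiv_dfinsupp A G
  choose v e ψ he hev hψ hgen using fun y : s =>
    IsSimpleModule.exists_idempotent_generator (A := A) (L := y.1)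
  have hfv : ∀ y, f (f.symm (DFinsupp.single y (v y))) = DFinsupp.single y (v y) := fun y =>
    f.apply_symm_apply _
  refine ⟨s, fun y => f.symm (DFinsupp.single y (v y)), e,
    fun y => (ψ y).comp ((DFinsupp.lapply y).comp f.toLinearMap), he, fun y => ?_, fun y => ?_,
    fun y y' hyy => ?_, fun g => ⟨(f g).support, fun y hy => ?_, ?_⟩⟩
  · rw [← map_smul, ← DFinsupp.single_smul, hev]
  · change ψ y (f (f.symm _) y) = _
    rw [hfv, DFinsupp.single_eq_same, hψ]
  · change ψ y (f (f.symm _) y) = _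
    rw [hfv, DFinsupp.single_eq_of_ne hyy, map_zero]
  · change ψ y (f g y) = 0
    rw [DFinsupp.notMem_support_iff.1 hy, map_zero]
  · refine f.injective ?_
    rw [map_sum]
    conv_lhs => rw [← (f g).sum_single, DFinsupp.sum]
    refine Finset.sum_congr rfl fun y _ => ?_
    rw [map_smul, hfv, ← DFinsupp.single_smul]
    congr 1
    exact (hgen y (f g y)).symm

end Semisimple

/-- An `R`-module annihilated by a two-sided ideal `K` with semisimple quotient ring is a direct sum
of left ideals of `R ⧸ K` generated by idempotents. -/
theorem exists_idempotent_coordinates_of_annihilated {R : Type u} [Ring R] (K : Ideal R)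
    [K.IsTwoSided] [IsSemisimpleRing (R ⧸ K)] (G : Type u) [AddCommGroup G] [Module R G]
    (hG : ∀ k ∈ K, ∀ g : G, k • g = 0) :
    ∃ (Y : Type u) (v : Y → G) (e : Y → R) (φ : Y → G →ₗ[R] R ⧸ K),
      (∀ y, e y * e y - e y ∈ K) ∧ (∀ y, e y • v y = v y) ∧
      (∀ y, φ y (v y) = Ideal.Quotient.mk K (e y)) ∧
      (∀ y y', y ≠ y' → φ y (v y') = 0) ∧
      ∀ g, ∃ T : Finset Y, (∀ y ∉ T, φ y g = 0) ∧
        ∀ a : Y → R, (∀ y, Ideal.Quotient.mk K (a y) = φ y g) → g = ∑ y ∈ T, a y • v y := by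
  have hM : Module.IsTorsionBySet R G K := fun g k => hG k.1 k.2 g
  let := hM.module
  have hsmul : ∀ (a : R) (g : G), Ideal.Quotient.mk K a • g = a • g := fun _ _ => rfl
  obtain ⟨Y, v, e, φ, he, hev, hφ, hφ', hgen⟩ :=
    IsSemisimpleRing.exists_idempotent_coordinates (R ⧸ K) G
  choose e' he' using fun y => Ideal.Quotient.mk_surjective (e y)
  let φ' : Y → G →ₗ[R] R ⧸ K := fun y =>
    { toFun := φ y
      map_add' := (φ y).map_add
      map_smul' := fun a g => by
        rw [← hsmul, map_smul, RingHom.id_apply]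
        obtain ⟨b, hb⟩ := Ideal.Quotient.mk_surjective (φ y g)
        rw [← hb]
        rfl }
  refine ⟨Y, v, e', φ', fun y => ?_, fun y => ?_, fun y => ?_, hφ', fun g => ?_⟩
  · rw [← Ideal.Quotient.mk_eq_mk_iff_sub_mem, map_mul, he']
    exact he y
  · rw [← hsmul, he', hev]
  · rw [he']
    exact hφ y
  · obtain ⟨T, hT, hg⟩ := hgen g
    refine ⟨T, hT, fun a ha => hg.trans (Finset.sum_congr rfl fun y _ => ?_)⟩
    rw [← hsmul, ha]
    rfl

/-! ### Lifting the coordinates of the reduction of F. -/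

section System

variable {R : Type u} [Ring R] [UniformSpace R] [IsUniformAddGroup R] [IsTopologicalRing R]
  [CompleteSpace R] [T2Space R] [IsLinearTopology Rᵐᵒᵖ R]

open FormalSum

/-- A presentation of an ideal `H` as the intersection of pairwise comaximal open two-sided ideals
with semisimple quotient rings, such that families converging to zero modulo `H` lift. -/
structure SemisimpleSystem (H : Ideal R) (Γ : Type u) where
  /-- the kernels of the projections -/
  K : Γ → Ideal R
  isTwoSided : ∀ γ, (K γ).IsTwoSided
  isOpen : ∀ γ, IsOpen (K γ : Set R)
  semisimple : ∀ γ, IsSemisimpleRing (R ⧸ K γ)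
  /-- lifts of the central idempotents -/
  ε : Γ → R
  ε_mem : ∀ γ γ', γ' ≠ γ → ε γ ∈ K γ'
  ε_sub_one_mem : ∀ γ, ε γ - 1 ∈ K γ
  mem_iff : ∀ a, a ∈ H ↔ ∀ γ, a ∈ K γ
  exists_lift : ∀ {X : Type u} (s : X → R), (∀ γ, {x | s x ∉ K γ}.Finite) →
    ∃ r : FormalSum R X, ∀ x, r.1 x - s x ∈ H

/-- Lifts to a contramodule `F` and to the ring `R` of a system of idempotent generators of the
reduction of `F`, and of the coordinates with respect to these generators. -/
structure CoordinateSystem {H : Ideal R} {Γ : Type u} (D : SemisimpleSystem H Γ)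
    (F : Contramodule R) (X : Type u) where
  /-- the component containing a generator -/
  γ : X → Γ
  /-- the generators -/
  f : X → F.carrier
  /-- the idempotents -/
  e : X → R
  /-- the coordinates -/
  φ : X → F.carrier → R
  isIdempotentElem : ∀ x, IsIdempotentElem (e x)
  e_smul : ∀ x, e x • f x = f x
  φ_add : ∀ x c d, φ x (c + d) - (φ x c + φ x d) ∈ H
  φ_act : ∀ x (r : FormalSum R F.carrier) (T : Finset F.carrier),
    (∀ c ∉ T, r.1 c ∈ D.K (γ x)) → φ x (F.act r) - ∑ c ∈ T, r.1 c * φ x c ∈ H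
  φ_self : ∀ x, φ x (f x) - e x ∈ H
  φ_of_ne : ∀ x x', x ≠ x' → φ x (f x') ∈ H
  finite : ∀ γ' c, {x | φ x c ∉ D.K γ'}.Finite
  sub_sum_mem : ∀ γ' c (T : Finset X), (∀ x ∉ T, φ x c ∈ D.K γ') →
    c - ∑ x ∈ T, φ x c • f x ∈ F.idealSpan (D.K γ')

namespace SemisimpleSystem

variable {H : Ideal R} {Γ : Type u} (D : SemisimpleSystem H Γ)
include D

theorem isClosed_K (γ : Γ) : IsClosed (D.K γ : Set R) :=
  (D.K γ).toAddSubgroup.isClosed_of_isOpen (D.isOpen γ)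

theorem mem_of_forall_ne (γ : Γ) {a : R} (h : a ∈ D.K γ) (h' : ∀ γ', γ' ≠ γ → a ∈ D.K γ') :
    a ∈ H :=
  (D.mem_iff a).2 fun γ' => by
    by_cases e : γ' = γ
    · rw [e]; exact h
    · exact h' γ' e

theorem le (γ : Γ) {a : R} (h : a ∈ H) : a ∈ D.K γ := (D.mem_iff a).1 h γ

theorem isTwoSided_inf : H.IsTwoSided where
  mul_mem_of_left b ha := (D.mem_iff _).2 fun γ =>
    have := D.isTwoSided γ
    (D.K γ).mul_mem_right b (D.le γ ha)

theorem isClosed_inf : IsClosed (H : Set R) := by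
  have : (H : Set R) = ⋂ γ, (D.K γ : Set R) := by
    ext a
    rw [Set.mem_iInter]
    exact D.mem_iff a
  rw [this]
  exact isClosed_iInter D.isClosed_K

open Contramodule

/-- Lift the central idempotents to a zero-convergent family r_γ with sum 1 modulo H. Then c agrees
with ∑ r_γ c modulo HF; writing c as a combination with coefficients in K_γ makes the coefficients
of r_γ c lie in r_γ K_γ ⊆ H. -/
theorem mem_idealSpan_of_forall {F : Contramodule R} {c : F.carrier}
    (h : ∀ γ, c ∈ F.idealSpan (D.K γ)) : c ∈ F.idealSpan H := by
  classical
  choose t ht htc using h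
  obtain ⟨r, hr⟩ := D.exists_lift D.ε fun γ => (Set.finite_singleton γ).subset fun γ' hγ' => by
    by_contra hne
    exact hγ' (D.ε_mem γ' γ (Ne.symm hne))
  have hrne : ∀ γ γ', γ' ≠ γ → r.1 γ ∈ D.K γ' := fun γ γ' hne => by
    have := (D.K γ').add_mem (D.le γ' (hr γ)) (D.ε_mem γ γ' hne)
    rwa [sub_add_cancel] at this
  have hsum : ∑' γ, r.1 γ - 1 ∈ H := by
    refine (D.mem_iff _).2 fun γ => ?_
    have h1 := tsum_sub_sum_mem r.2 (D.K γ).toAddSubgroup (D.isOpen γ) {γ} fun γ' hγ' =>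
      hrne γ' γ fun e => hγ' (by rw [e]; exact Finset.mem_singleton_self _)
    rw [Finset.sum_singleton] at h1
    have h2 := (D.K γ).add_mem (D.le γ (hr γ)) (D.ε_sub_one_mem γ)
    have h3 := (D.K γ).add_mem h1 h2
    simpa only [sub_add_sub_cancel] using h3
  have h1 : (∑' γ, r.1 γ) • c ∈ F.idealSpan H := by
    rw [← lin_const]
    have : (fun _ : Γ => c) = fun γ => lin id (t γ) := funext fun γ => by rw [lin_id, htc]
    rw [this, ← lin_bind, lin_id]
    refine ⟨_, fun x => ?_, rfl⟩
    refine bind_mem (V := H.toAddSubgroup) D.isClosed_inf t x fun γ => ?_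
    have := D.isTwoSided
    refine D.mem_of_forall_ne γ ((D.K γ).mul_mem_left _ (ht γ x)) fun γ' hne => ?_
    have := D.isTwoSided γ'
    exact (D.K γ').mul_mem_right _ (hrne γ γ' hne)
  have h2 := (F.idealSpan H).sub_mem h1 (smul_mem_idealSpan hsum c)
  rwa [← sub_smul, sub_sub_cancel, one_smul] at h2

/-- Coordinates on F/K_γF are lifted to R and multiplied by ε_γ. This puts them in all the other
K_γ', so that every identity valid modulo K_γ holds modulo H. -/
theorem exists_component (hT : IsTopLeftTNilpotent H) (F : Contramodule R) (γ : Γ) :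
    ∃ (Y : Type u) (f : Y → F.carrier) (e : Y → R) (φ : Y → F.carrier → R),
      (∀ y, IsIdempotentElem (e y)) ∧ (∀ y, ∀ γ', γ' ≠ γ → e y ∈ D.K γ') ∧
      (∀ y, e y • f y = f y) ∧ (∀ y c, ∀ γ', γ' ≠ γ → φ y c ∈ D.K γ') ∧
      (∀ y c d, φ y (c + d) - (φ y c + φ y d) ∈ H) ∧
      (∀ y (r : FormalSum R F.carrier) (T : Finset F.carrier),
        (∀ c ∉ T, r.1 c ∈ D.K γ) → φ y (F.act r) - ∑ c ∈ T, r.1 c * φ y c ∈ H) ∧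
      (∀ y, φ y (f y) - e y ∈ H) ∧ (∀ y y', y ≠ y' → φ y (f y') ∈ H) ∧
      (∀ y, ∀ c ∈ F.idealSpan (D.K γ), φ y c ∈ H) ∧
      (∀ c, {y | φ y c ∉ D.K γ}.Finite) ∧
      ∀ c (T : Finset Y), (∀ y ∉ T, φ y c ∈ D.K γ) →
        c - ∑ y ∈ T, φ y c • f y ∈ F.idealSpan (D.K γ) := by
  classical
  have := D.isTwoSided γ
  have := D.semisimple γ
  have := D.isTwoSided_inf
  set π := (F.idealSpan (D.K γ)).mkQ with hπ
  have hπ0 : ∀ c, π c = 0 ↔ c ∈ F.idealSpan (D.K γ) := fun c => by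
    rw [hπ, Submodule.mkQ_apply, Submodule.Quotient.mk_eq_zero]
  obtain ⟨Y, v, e₀, φ₀, he, hev, hφ, hφ', hgen⟩ :=
    exists_idempotent_coordinates_of_annihilated (D.K γ) (F.carrier ⧸ F.idealSpan (D.K γ))
      (by
        intro k hk g
        obtain ⟨c, rfl⟩ := Submodule.mkQ_surjective _ g
        rw [← map_smul]
        exact (hπ0 _).2 (smul_mem_idealSpan hk c))
  let mk := Ideal.Quotient.mk (D.K γ)
  have hmk : ∀ a, mk a = 0 ↔ a ∈ D.K γ := fun a => Ideal.Quotient.eq_zero_iff_mem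
  have hmk' : ∀ a b, mk a = mk b ↔ a - b ∈ D.K γ := fun a b =>
    Ideal.Quotient.mk_eq_mk_iff_sub_mem a b
  have hε : mk (D.ε γ) = 1 := by
    rw [← map_one mk, hmk']
    exact D.ε_sub_one_mem γ
  have hmkε : ∀ a, mk (a * D.ε γ) = mk a := fun a => by rw [map_mul, hε, mul_one]
  have hε' : ∀ (a : R) γ', γ' ≠ γ → a * D.ε γ ∈ D.K γ' := fun a γ' hne =>
    (D.K γ').mul_mem_left _ (D.ε_mem γ γ' hne)
  -- The lift e₀ is idempotent only modulo K_γ; the factor ε_γ makes it idempotent modulo H, where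
  -- Newton iteration applies.
  choose e hidem he' using fun y => exists_isIdempotentElem_sub_mem (H := H)
    (a := e₀ y * D.ε γ) D.isClosed_inf hT
    (D.mem_of_forall_ne γ (by rw [← hmk', map_mul, hmkε, ← map_mul, hmk']; exact he y)
      fun γ' hne => (D.K γ').sub_mem ((D.K γ').mul_mem_left _ (hε' _ γ' hne)) (hε' _ γ' hne))
  have hmke : ∀ y, mk (e y) = mk (e₀ y) := fun y => by
    rw [← hmkε (e₀ y), hmk']
    exact D.le γ (he' y)
  have heK : ∀ y, ∀ γ', γ' ≠ γ → e y ∈ D.K γ' := fun y γ' hne => by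
    have := (D.K γ').add_mem (D.le γ' (he' y)) (hε' (e₀ y) γ' hne)
    rwa [sub_add_cancel] at this
  choose w hw using fun y => Submodule.mkQ_surjective (F.idealSpan (D.K γ)) (v y)
  choose σ hσ using fun z : R ⧸ D.K γ => Ideal.Quotient.mk_surjective z
  let φ : Y → F.carrier → R := fun y c => σ (φ₀ y (π c)) * D.ε γ
  have hφmk : ∀ y c, mk (φ y c) = φ₀ y (π c) := fun y c => by rw [hmkε]; exact hσ _
  have hφK : ∀ y c, ∀ γ', γ' ≠ γ → φ y c ∈ D.K γ' := fun y c => hε' _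
  have hsmulK : ∀ (a b : R) (g : F.carrier ⧸ F.idealSpan (D.K γ)), mk a = mk b →
      a • g = b • g := by
    intro a b g hab
    obtain ⟨c, rfl⟩ := Submodule.mkQ_surjective _ g
    rw [← sub_eq_zero, ← sub_smul, ← map_smul]
    exact (hπ0 _).2 (smul_mem_idealSpan ((hmk' a b).1 hab) c)
  have hπf : ∀ y, π (e y • w y) = v y := fun y => by
    rw [map_smul, hw, hsmulK _ _ _ (hmke y), hev]
  -- Replacing a lift w of v by e w leaves its class unchanged and makes it exactly fixed by e.
  refine ⟨Y, fun y => e y • w y, e, φ, hidem, heK, fun y => ?_, hφK, fun y c d => ?_,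
    fun y r T hrT => ?_, fun y => ?_, fun y y' hne => ?_, fun y c hc => ?_, fun c => ?_,
    fun c T hcT => ?_⟩
  · rw [← mul_smul, hidem y]
  · refine D.mem_of_forall_ne γ ?_ fun γ' hne =>
      (D.K γ').sub_mem (hφK _ _ _ hne) ((D.K γ').add_mem (hφK _ _ _ hne) (hφK _ _ _ hne))
    rw [← hmk', map_add, hφmk, hφmk, hφmk, map_add, map_add]
  · refine D.mem_of_forall_ne γ ?_ fun γ' hne => (D.K γ').sub_mem (hφK _ _ _ hne)
      ((D.K γ').sum_mem fun c _ => (D.K γ').mul_mem_left _ (hφK _ _ _ hne))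
    have h1 := lin_sub_sum_mem_idealSpan (D.isOpen γ) id r T hrT
    rw [← hπ0, map_sub, lin_id, sub_eq_zero, map_sum] at h1
    rw [← hmk', hφmk, h1, map_sum, map_sum]
    refine Finset.sum_congr rfl fun c _ => ?_
    rw [map_smul, map_smul, map_mul, hφmk]
    obtain ⟨b, hb⟩ := Ideal.Quotient.mk_surjective (φ₀ y (π c))
    change r.1 c • φ₀ y (π c) = _
    rw [← hb]
    rfl
  · refine D.mem_of_forall_ne γ ?_ fun γ' hne =>
      (D.K γ').sub_mem (hφK _ _ _ hne) (heK _ _ hne)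
    rw [← hmk', hφmk, hπf, hφ, hmke]
  · refine D.mem_of_forall_ne γ ?_ fun γ' => hφK _ _ _
    rw [← hmk, hφmk, hπf, hφ' y y' hne]
  · refine D.mem_of_forall_ne γ ?_ fun γ' => hφK _ _ _
    rw [← hmk, hφmk, (hπ0 c).2 hc, map_zero]
  · obtain ⟨T, hT, -⟩ := hgen (π c)
    refine T.finite_toSet.subset fun y hy => ?_
    by_contra hyT
    refine hy ?_
    rw [← hmk, hφmk, hT y hyT]
  · obtain ⟨T', hT', hg⟩ := hgen (π c)
    have h1 := hg (fun y => φ y c) fun y => hφmk y c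
    rw [← hπ0, map_sub, sub_eq_zero, map_sum]
    refine h1.trans (Eq.trans ?_ (Finset.sum_congr rfl fun y _ => ?_ :
      ∑ y ∈ T, φ y c • v y = _))
    · have hz : ∀ y, φ y c ∈ D.K γ → φ y c • v y = 0 := fun y hy => by
        rw [hsmulK _ 0 _ (by rw [map_zero]; exact (hmk _).2 hy), zero_smul]
      exact (Finset.sum_subset Finset.subset_union_left fun y _ hy =>
          hz y (by rw [← hmk, hφmk, hT' y hy])).trans
        (Finset.sum_subset (Finset.subset_union_right (s₁ := T')) fun y _ hy =>
          hz y (hcT y hy)).symm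
    · rw [map_smul, hπf]

/-- The components are put side by side. They do not interfere: a generator f = e f from component γ
has e in K_γ' for γ' ≠ γ, so it lies in K_γ'F and its coordinates there vanish modulo H. -/
theorem exists_coordinateSystem (hT : IsTopLeftTNilpotent H) (F : Contramodule R) :
    ∃ X : Type u, Nonempty (CoordinateSystem D F X) := by
  classical
  choose Y f e φ hidem heK hef hφK hadd hact hself hne hspan hfin hsub using
    fun γ => D.exists_component hT F γ
  have hfspan : ∀ γ γ' (y : Y γ), γ' ≠ γ → f γ y ∈ F.idealSpan (D.K γ') := fun γ γ' y h => by
    rw [← hef]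
    exact smul_mem_idealSpan (heK γ y γ' h) _
  have hfin' : ∀ γ' c, {x : Σ γ, Y γ | φ x.1 x.2 c ∉ D.K γ'}.Finite := fun γ' c => by
    refine ((hfin γ' c).image (Sigma.mk γ')).subset ?_
    rintro ⟨γ, y⟩ hy
    by_cases h : γ' = γ
    · subst h
      exact ⟨y, hy, rfl⟩
    · exact absurd (hφK γ y c γ' h) hy
  refine ⟨Σ γ, Y γ, ⟨⟨fun x => x.1, fun x => f x.1 x.2, fun x => e x.1 x.2,
    fun x => φ x.1 x.2, fun x => hidem _ _, fun x => hef _ _, fun x => hadd _ _,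
    fun x => hact _ _, fun x => hself _ _, ?_, hfin', fun γ' c T hcT => ?_⟩⟩⟩
  · rintro ⟨γ, y⟩ ⟨γ', y'⟩ h
    by_cases hγ : γ = γ'
    · subst hγ
      exact hne γ y y' fun e => h (by rw [e])
    · exact hspan γ y _ (hfspan γ' γ y' hγ)
  · let T' : Finset (Y γ') := T.preimage (Sigma.mk γ') sigma_mk_injective.injOn
    have h1 := hsub γ' c T' fun y hy => hcT ⟨γ', y⟩ fun h => hy (Finset.mem_preimage.2 h)
    have hle : T'.image (Sigma.mk γ') ⊆ T := Finset.image_subset_iff.2 fun y hy =>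
      Finset.mem_preimage.1 hy
    have h2 : ∑ x ∈ T, φ x.1 x.2 c • f x.1 x.2 - ∑ y ∈ T', φ γ' y c • f γ' y ∈
        F.idealSpan (D.K γ') := by
      rw [← Finset.sum_image (s := T') (g := Sigma.mk γ')
        (f := fun x : Σ γ, Y γ => φ x.1 x.2 c • f x.1 x.2) sigma_mk_injective.injOn,
        ← Finset.sum_sdiff hle, add_sub_cancel_right]
      refine (F.idealSpan (D.K γ')).sum_mem fun x hx => ?_
      obtain ⟨γ, y⟩ := x
      rw [Finset.mem_sdiff] at hx
      refine (F.idealSpan (D.K γ')).smul_mem _ (hfspan γ γ' y fun h => hx.2 ?_)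
      subst h
      exact Finset.mem_image_of_mem _ (Finset.mem_preimage.2 hx.1)
    have h3 := (F.idealSpan (D.K γ')).sub_mem h1 h2
    rwa [sub_sub, add_sub_cancel] at h3

end SemisimpleSystem

namespace CoordinateSystem

open Contramodule

variable {H : Ideal R} {Γ : Type u} {D : SemisimpleSystem H Γ} {F : Contramodule R} {X : Type u}
  (B : CoordinateSystem D F X)
include B

/-- Modulo each K_γ only finitely many coordinates of c survive, so the whole family lifts to a
formal sum. Its value agrees with c modulo every K_γF, hence modulo HF. -/
theorem exists_sub_lin_mem_idealSpan (c : F.carrier) :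
    ∃ r : FormalSum R X, c - lin B.f r ∈ F.idealSpan H := by
  obtain ⟨r, hr⟩ := D.exists_lift (fun x => B.φ x c) fun γ => B.finite γ c
  refine ⟨r, D.mem_idealSpan_of_forall fun γ => ?_⟩
  let T := (B.finite γ c).toFinset
  have hT : ∀ x ∉ T, B.φ x c ∈ D.K γ := fun x hx => by
    by_contra h
    exact hx ((B.finite γ c).mem_toFinset.2 h)
  have h1 := B.sub_sum_mem γ c T hT
  have h2 := lin_sub_sum_mem_idealSpan (D.isOpen γ) B.f r T fun x hx => by
    have := (D.K γ).add_mem (D.le γ (hr x)) (hT x hx)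
    rwa [sub_add_cancel] at this
  have h3 : ∑ x ∈ T, (r.1 x - B.φ x c) • B.f x ∈ F.idealSpan (D.K γ) :=
    (F.idealSpan (D.K γ)).sum_mem fun x _ => smul_mem_idealSpan (D.le γ (hr x)) _
  simp only [sub_smul, Finset.sum_sub_distrib] at h3
  have h4 := (F.idealSpan (D.K γ)).sub_mem h1 ((F.idealSpan (D.K γ)).add_mem h2 h3)
  convert h4 using 1
  abel

/-- The generators generate the contramodule. -/
theorem exists_lin_eq (hT : IsTopLeftTNilpotent H) (c : F.carrier) :
    ∃ r : FormalSum R X, (∀ x, r.1 x * B.e x = r.1 x) ∧ lin B.f r = c := by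
  obtain ⟨r, hr⟩ := mem_of_forall_exists_sub_mem_idealSpan hT (lin B.f).range
    (fun g hg r => by
      choose s hs using hg
      refine ⟨FormalSum.bind s r, ?_⟩
      rw [lin_bind]
      congr 2
      exact funext hs)
    (fun c => by
      obtain ⟨r, hr⟩ := B.exists_sub_lin_mem_idealSpan c
      exact ⟨_, hr, r, (sub_sub_cancel _ _).symm⟩) c
  -- Multiplying the coefficients by the e_x normalizes them without changing the value, since e_x
  -- f_x = f_x.
  refine ⟨mulRight B.e r, fun x => ?_, ?_⟩
  · rw [mulRight_apply, mul_assoc, B.isIdempotentElem x]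
  · rw [lin_mulRight, ← hr]
    congr 2
    exact funext B.e_smul

end CoordinateSystem

end System

/-! ### Discrete right modules. -/

section DiscreteModules

variable {R : Type u} [Ring R] [UniformSpace R] [IsUniformAddGroup R] [IsTopologicalRing R]
  [CompleteSpace R] [T2Space R] [IsLinearTopology Rᵐᵒᵖ R]

/-- The annihilator of an element of a right module. -/
def annihilatorOf {N : Type v} [AddCommGroup N] [Module Rᵐᵒᵖ N] (b : N) : AddSubgroup R where
  carrier := {r | MulOpposite.op r • b = 0}
  zero_mem' := by simp
  add_mem' {r s} hr hs := by
    change MulOpposite.op (r + s) • b = 0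
    rw [MulOpposite.op_add, add_smul, hr, hs, add_zero]
  neg_mem' {r} hr := by
    change MulOpposite.op (-r) • b = 0
    rw [MulOpposite.op_neg, neg_smul, hr, neg_zero]

theorem isDiscreteRightModule_of_surjective {N : Type v} {N' : Type w} [AddCommGroup N]
    [Module Rᵐᵒᵖ N] [AddCommGroup N'] [Module Rᵐᵒᵖ N'] [IsDiscreteRightModule R N]
    (g : N →ₗ[Rᵐᵒᵖ] N') (hg : Function.Surjective g) : IsDiscreteRightModule R N' where
  isOpen_annihilator b := by
    obtain ⟨b, rfl⟩ := hg b
    refine AddSubgroup.isOpen_mono (H₁ := annihilatorOf b) (H₂ := annihilatorOf (g b))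
      (fun r hr => ?_) (IsDiscreteRightModule.isOpen_annihilator b)
    change MulOpposite.op r • g b = 0
    rw [← map_smul, show MulOpposite.op r • b = 0 from hr, map_zero]

theorem isDiscreteRightModule_of_injective {N : Type v} {N' : Type w} [AddCommGroup N]
    [Module Rᵐᵒᵖ N] [AddCommGroup N'] [Module Rᵐᵒᵖ N'] [IsDiscreteRightModule R N']
    (g : N →ₗ[Rᵐᵒᵖ] N') (hg : Function.Injective g) : IsDiscreteRightModule R N where
  isOpen_annihilator b := by
    convert IsDiscreteRightModule.isOpen_annihilator (R := R) (g b) using 1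
    ext r
    change _ = 0 ↔ _ = 0
    rw [← map_smul, map_eq_zero_iff g hg]

theorem isDiscreteRightModule_quotient {J : Submodule Rᵐᵒᵖ R} (hJ : IsOpen (J : Set R)) :
    IsDiscreteRightModule R (R ⧸ J) where
  isOpen_annihilator b := by
    obtain ⟨a, rfl⟩ := J.mkQ_surjective b
    have h : {r : R | MulOpposite.op r • J.mkQ a = 0} = (fun r => a * r) ⁻¹' J := by
      ext r
      change _ = 0 ↔ a * r ∈ J
      rw [← map_smul, Submodule.mkQ_apply, Submodule.Quotient.mk_eq_zero]
      rfl
    rw [h]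
    exact hJ.preimage (continuous_const_mul a)

instance {N : Type v} [AddCommGroup N] [Module Rᵐᵒᵖ N] [IsDiscreteRightModule R N]
    (M : Submodule Rᵐᵒᵖ N) : IsDiscreteRightModule R M :=
  isDiscreteRightModule_of_injective M.subtype M.injective_subtype

instance {N : Type v} [AddCommGroup N] [Module Rᵐᵒᵖ N] [IsDiscreteRightModule R N]
    (M : Submodule Rᵐᵒᵖ N) : IsDiscreteRightModule R (N ⧸ M) :=
  isDiscreteRightModule_of_surjective M.mkQ M.mkQ_surjective

theorem FormalSum.smulLeft_apply {N : Type v} [AddCommGroup N] [Module Rᵐᵒᵖ N]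
    [IsDiscreteRightModule R N] {X : Type w} (b : N) (r : FormalSum R X) (x : X) :
    FormalSum.smulLeft b r x = MulOpposite.op (r.1 x) • b := rfl

/-- The annihilator of b is an open, hence closed, subgroup. It contains the coefficients of r
outside the finite support, and so also their infinite fibre sums; only finitely many monomials
remain. -/
theorem FormalSum.smulLeft_map {N : Type v} [AddCommGroup N] [Module Rᵐᵒᵖ N]
    [IsDiscreteRightModule R N] {X Y : Type u} (f : X → Y) (b : N) (r : FormalSum R X) :
    FormalSum.smulLeft b (FormalSum.map f r) = (FormalSum.smulLeft b r).mapDomain f := by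
  classical
  have hV : IsOpen ((annihilatorOf b : AddSubgroup R) : Set R) :=
    IsDiscreteRightModule.isOpen_annihilator b
  have h1 := fun y => FormalSum.map_mem ((annihilatorOf b).isClosed_of_isOpen hV) f
    (FormalSum.sub_sum_single_mem r (annihilatorOf b) (FormalSum.smulLeft b r).support
      fun x hx => Finsupp.notMem_support_iff.1 hx) y
  ext y
  have h2 : MulOpposite.op ((FormalSum.map f (r - ∑ x ∈ (FormalSum.smulLeft b r).support,
    FormalSum.single (r.1 x) x)).1 y) • b = 0 := h1 y
  rw [map_sub, map_sum, AddSubgroup.coe_sub, Pi.sub_apply, MulOpposite.op_sub, sub_smul,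
    sub_eq_zero, AddSubgroup.val_finsetSum, Finset.sum_apply, Finset.op_sum,
    Finset.sum_smul] at h2
  rw [smulLeft_apply, h2, Finsupp.mapDomain, Finsupp.sum, Finsupp.finsetSum_apply]
  refine Finset.sum_congr rfl fun x _ => ?_
  rw [FormalSum.map_single]
  by_cases h : y = f x
  · rw [h, single_self, Finsupp.single_eq_same, smulLeft_apply]
  · rw [single_of_ne _ h, Finsupp.single_eq_of_ne h, MulOpposite.op_zero, zero_smul]

end DiscreteModules

/-! ### Contratensor products and the use of flatness. -/

section Contratensor

variable {R : Type u} [Ring R] [UniformSpace R] [IsUniformAddGroup R] [IsTopologicalRing R]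
  [CompleteSpace R] [T2Space R] [IsLinearTopology Rᵐᵒᵖ R]

namespace Contratensor

variable {N : Type v} [AddCommGroup N] [Module Rᵐᵒᵖ N] [IsDiscreteRightModule R N]

/-- The class of a pure tensor in the contratensor product. -/
noncomputable def tmul {F : Contramodule R} (b : N) (c : F.carrier) : Contratensor N F :=
  QuotientAddGroup.mk' (relations N F) (b ⊗ₜ[ℤ] c)

theorem tmul_zero {F : Contramodule R} (b : N) : tmul b (0 : F.carrier) = 0 := by
  rw [tmul, TensorProduct.tmul_zero, map_zero]

theorem tmul_lin {F : Contramodule R} {X : Type u} (b : N) (f : X → F.carrier)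
    (r : FormalSum R X) :
    tmul b (Contramodule.lin f r) = (FormalSum.smulLeft b r).sum fun x n => tmul n (f x) := by
  have h1 : tmul b (F.act (FormalSum.map f r)) = QuotientAddGroup.mk' (relations N F)
      ((FormalSum.smulLeft b (FormalSum.map f r)).sum fun c n => n ⊗ₜ[ℤ] c) := by
    rw [tmul, ← sub_eq_zero, ← map_sub]
    exact (QuotientAddGroup.eq_zero_iff _).2 (AddSubgroup.subset_closure ⟨(b, _), rfl⟩)
  rw [Contramodule.lin_apply, h1, FormalSum.smulLeft_map,
    Finsupp.sum_mapDomain_index (h := fun c n => n ⊗ₜ[ℤ] c)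
      (fun _ => TensorProduct.zero_tmul _ _) (fun _ _ _ => TensorProduct.add_tmul _ _ _), Finsupp.sum, map_sum]
  rfl

theorem map_tmul {N' : Type w} [AddCommGroup N'] [Module Rᵐᵒᵖ N'] [IsDiscreteRightModule R N']
    (g : N →ₗ[Rᵐᵒᵖ] N') {F : Contramodule R} (b : N) (c : F.carrier) :
    map g F (tmul b c) = tmul (g b) c := rfl

/-- A family of right multiplications that is linear modulo an ideal annihilating `N` defines a
homomorphism from the contratensor product to `N`. -/
theorem exists_hom_of_coordinate {H : Ideal R} {V : Set R} (hV : V ∈ 𝓝 (0 : R))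
    (hN : ∀ h ∈ H, ∀ b : N, MulOpposite.op h • b = 0) {F : Contramodule R} (φ : F.carrier → R)
    (hadd : ∀ c d, φ (c + d) - (φ c + φ d) ∈ H)
    (hact : ∀ (r : FormalSum R F.carrier) (T : Finset F.carrier), (∀ c ∉ T, r.1 c ∈ V) →
      φ (F.act r) - ∑ c ∈ T, r.1 c * φ c ∈ H) :
    ∃ ψ : Contratensor N F →+ N, ∀ b c, ψ (tmul b c) = MulOpposite.op (φ c) • b := by
  classical
  have heq : ∀ a a' : R, a - a' ∈ H → ∀ b : N,
      MulOpposite.op a • b = MulOpposite.op a' • b := fun a a' h b => by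
    rw [← sub_eq_zero, ← sub_smul, ← MulOpposite.op_sub, hN _ h]
  let β : N →+ F.carrier →+ N := AddMonoidHom.mk'
    (fun b => AddMonoidHom.mk' (fun c => MulOpposite.op (φ c) • b) fun c d => by
      rw [heq _ _ (hadd c d), MulOpposite.op_add, add_smul])
    fun b b' => AddMonoidHom.ext fun c => smul_add _ _ _
  let ψ₀ : N ⊗[ℤ] F.carrier →+ N := TensorProduct.liftAddHom β fun k b c => by
    rw [map_zsmul, map_zsmul]
    rfl
  have hψ₀ : ∀ b c, ψ₀ (b ⊗ₜ[ℤ] c) = MulOpposite.op (φ c) • b := fun b c =>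
    TensorProduct.liftAddHom_tmul _ _ _ _
  refine ⟨QuotientAddGroup.lift (relations N F) ψ₀ ?_, hψ₀⟩
  rw [relations, AddSubgroup.closure_le]
  rintro _ ⟨⟨b, r⟩, rfl⟩
  change ψ₀ (b ⊗ₜ[ℤ] F.act r - (FormalSum.smulLeft b r).sum fun c n => n ⊗ₜ[ℤ] c) = 0
  have hfin := FormalSum.finite_notMem r hV
  have h1 := hact r ((FormalSum.smulLeft b r).support ∪ hfin.toFinset) fun c hc => by
    by_contra h
    exact hc (Finset.mem_union_right _ (hfin.mem_toFinset.2 h))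
  rw [map_sub, hψ₀, heq _ _ h1, Finset.op_sum, Finset.sum_smul,
    Finsupp.sum_of_support_subset _ Finset.subset_union_left
      (fun c n => n ⊗ₜ[ℤ] c) fun _ _ => TensorProduct.zero_tmul _ _, map_sum, sub_eq_zero]
  refine Finset.sum_congr rfl fun c _ => ?_
  rw [hψ₀, FormalSum.smulLeft_apply, MulOpposite.op_mul, mul_smul]

end Contratensor

/-- The submodule of a right module annihilated by a two-sided ideal. -/
def annihilatedBy (H : Ideal R) [H.IsTwoSided] (N : Type v) [AddCommGroup N] [Module Rᵐᵒᵖ N] :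
    Submodule Rᵐᵒᵖ N where
  carrier := {b | ∀ h ∈ H, MulOpposite.op h • b = 0}
  zero_mem' h _ := smul_zero _
  add_mem' hb hc h hh := by rw [smul_add, hb h hh, hc h hh, add_zero]
  smul_mem' s b hb h hh := by
    rw [← mul_smul]
    exact hb _ (H.mul_mem_left s.unop hh)

/-- Zorn's lemma above an open right ideal I missing some coefficient. Only finitely many
coefficients lie outside I, so if the union of a chain contained them all, so would one member. -/
theorem exists_maximal_right_ideal {X : Type u} (r : FormalSum R X) (hr : r ≠ 0) :
    ∃ J : Submodule Rᵐᵒᵖ R, IsOpen (J : Set R) ∧ (∃ x, r.1 x ∉ J) ∧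
      ∀ J', J ≤ J' → J' ≠ J → ∀ x, r.1 x ∈ J' := by
  classical
  obtain ⟨x₀, hx₀⟩ : ∃ x, r.1 x ≠ 0 := by
    by_contra! h
    exact hr (FormalSum.ext_apply h)
  obtain ⟨I, hI, hIx⟩ : ∃ I : Submodule Rᵐᵒᵖ R, IsOpen (I : Set R) ∧ r.1 x₀ ∉ I := by
    by_contra! h
    exact hx₀ (FormalSum.eq_zero_of_forall_mem h)
  have hfin := FormalSum.finite_of_tendsto r.2 I hI
  obtain ⟨J, hIJ, hJ⟩ := zorn_le_nonempty₀
    {J : Submodule Rᵐᵒᵖ R | I ≤ J ∧ ∃ x, r.1 x ∉ J} (fun c hc hchain J₀ hJ₀ => by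
      refine ⟨sSup c, ⟨(hc hJ₀).1.trans (le_sSup hJ₀), ?_⟩, fun J hJ => le_sSup hJ⟩
      by_contra! h
      have hdir := hchain.directedOn
      have key : ∀ T : Finset X, ∃ J ∈ c, ∀ x ∈ T, r.1 x ∈ J := by
        intro T
        induction T using Finset.induction_on with
        | empty => exact ⟨J₀, hJ₀, fun x hx => absurd hx (Finset.notMem_empty x)⟩
        | insert x T _ ih =>
          obtain ⟨J₁, hJ₁, h₁⟩ := ih
          obtain ⟨J₂, hJ₂, h₂⟩ := (Submodule.mem_sSup_of_directed ⟨J₀, hJ₀⟩ hdir).1 (h x)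
          obtain ⟨J₃, hJ₃, h13, h23⟩ := hdir J₁ hJ₁ J₂ hJ₂
          refine ⟨J₃, hJ₃, fun y hy => ?_⟩
          rcases Finset.mem_insert.1 hy with rfl | hy
          · exact h23 h₂
          · exact h13 (h₁ y hy)
      obtain ⟨J, hJc, hJ⟩ := key hfin.toFinset
      obtain ⟨x, hx⟩ := (hc hJc).2
      exact hx (by
        by_cases hxI : r.1 x ∈ I
        · exact (hc hJc).1 hxI
        · exact hJ x (hfin.mem_toFinset.2 hxI))) I ⟨le_rfl, x₀, hIx⟩
  refine ⟨J, AddSubgroup.isOpen_mono (H₁ := I.toAddSubgroup) (H₂ := J.toAddSubgroup) hIJ hI, hJ.1.2, fun J' hle hne x => ?_⟩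
  by_contra hx
  exact hne (le_antisymm (hJ.2 ⟨hIJ.trans hle, x, hx⟩ hle) hle)

/-- For a proper open right ideal `J` and a topologically left T-nilpotent ideal `H`, the right
module `R ⧸ J` has a nonzero element annihilated by `H`. -/
theorem exists_notMem_forall_mul_mem {H : Ideal R} (hT : IsTopLeftTNilpotent H)
    {J : Submodule Rᵐᵒᵖ R} (hJ : IsOpen (J : Set R)) (hJ1 : (1 : R) ∉ J) :
    ∃ a ∉ J, ∀ h ∈ H, a * h ∈ J := by
  by_contra! hc
  choose next hnH hnJ using fun a : {a : R // a ∉ J} => hc a.1 a.2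
  let q : ℕ → {a : R // a ∉ J} :=
    fun n => (fun a => ⟨a.1 * next a, hnJ a⟩)^[n] ⟨1, hJ1⟩
  have hq : ∀ n, (q n).1 = ((List.range n).map fun n => next (q n)).prod := by
    intro n
    induction n with
    | zero => rfl
    | succ n ih =>
      rw [List.range_succ, List.map_append, List.prod_append, ← ih, List.map_singleton,
        List.prod_singleton]
      change ((fun a : {a : R // a ∉ J} =>
        (⟨a.1 * next a, hnJ a⟩ : {a : R // a ∉ J}))^[n + 1] ⟨1, hJ1⟩).1 = _
      rw [Function.iterate_succ_apply']
  have ht := hT (fun n => next (q n)) fun n => hnH _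
  obtain ⟨n, hn⟩ := (ht.eventually (hJ.mem_nhds J.zero_mem)).exists
  refine (q (n + 1)).2 ?_
  rw [hq]
  exact hn

/-- Flatness transfers a relation among the f_x from R/J to its submodule M killed by H. On M the
coordinate φ_x, linear only modulo H, becomes a genuine functional and detects the coefficient. -/
theorem CoordinateSystem.eq_zero_of_lin_eq_zero {H : Ideal R} {Γ : Type u}
    {D : SemisimpleSystem H Γ} {F : Contramodule R} {X : Type u} (B : CoordinateSystem D F X)
    (hT : IsTopLeftTNilpotent H) (hF : F.Flat) {r : FormalSum R X}
    (hr : ∀ x, r.1 x * B.e x = r.1 x) (h : Contramodule.lin B.f r = 0) : r = 0 := by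
  by_contra hr0
  have := D.isTwoSided_inf
  obtain ⟨J, hJ, ⟨x₀, hx₀⟩, hmax⟩ := exists_maximal_right_ideal r hr0
  have := isDiscreteRightModule_quotient hJ
  set M := annihilatedBy H (R ⧸ J) with hM
  have hJ1 : (1 : R) ∉ J := fun h1 => hx₀ (by
    have := J.smul_mem (MulOpposite.op (r.1 x₀)) h1
    rwa [op_smul_eq_mul, one_mul] at this)
  have hMr : ∀ x, J.mkQ (r.1 x) ∈ M := by
    -- The preimage of M is strictly larger than J because M ≠ 0, so by maximality it contains every
    -- coefficient.
    refine hmax (M.comap J.mkQ) (fun a ha => ?_) fun heq => ?_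
    · rw [Submodule.mem_comap, Submodule.mkQ_apply, (Submodule.Quotient.mk_eq_zero J).2 ha]
      exact M.zero_mem
    · obtain ⟨a, haJ, ha⟩ := exists_notMem_forall_mul_mem hT hJ hJ1
      refine haJ (heq ▸ fun k hk => ?_)
      rw [← map_smul]
      exact (Submodule.Quotient.mk_eq_zero J).2 (ha k hk)
  obtain ⟨ψ, hψ⟩ := Contratensor.exists_hom_of_coordinate (N := M)
    ((D.isOpen (B.γ x₀)).mem_nhds (D.K (B.γ x₀)).zero_mem) (fun k hk b => Subtype.ext (b.2 k hk))
    (B.φ x₀) (B.φ_add x₀) (B.φ_act x₀)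
  let n : X → M := fun x => ⟨J.mkQ (r.1 x), hMr x⟩
  let T := (FormalSum.smulLeft (J.mkQ (1 : R)) r).support
  have hb : ∀ x, FormalSum.smulLeft (J.mkQ (1 : R)) r x = J.mkQ (r.1 x) := fun x => by
    rw [FormalSum.smulLeft_apply, ← map_smul, op_smul_eq_mul, one_mul]
  -- The image of this sum in the contratensor product with R/J is 1 ⊗ ∑ r_x f_x = 0, and flatness
  -- makes the map from M injective.
  have hz : ∑ x ∈ T, Contratensor.tmul (n x) (B.f x) = 0 := by
    refine (hF M (R ⧸ J) ((R ⧸ J) ⧸ M) M.subtype M.mkQ M.injective_subtype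
      (LinearMap.exact_subtype_mkQ M) M.mkQ_surjective).1 ?_
    rw [map_zero, map_sum, ← Contratensor.tmul_zero (F := F) (J.mkQ (1 : R)), ← h,
      Contratensor.tmul_lin, Finsupp.sum]
    refine Finset.sum_congr rfl fun x _ => ?_
    rw [Contratensor.map_tmul, hb]
    rfl
  have hkill : ∀ a ∈ H, ∀ b : M, MulOpposite.op a • b = 0 := fun a ha b =>
    Subtype.ext (b.2 a ha)
  have hx₀T : x₀ ∈ T := by
    rw [Finsupp.mem_support_iff, hb]
    exact fun h0 => hx₀ ((Submodule.Quotient.mk_eq_zero J).1 h0)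
  have h1 := congrArg ψ hz
  rw [map_zero, map_sum, Finset.sum_eq_single_of_mem x₀ hx₀T fun x _ hx => by
    rw [hψ, hkill _ (B.φ_of_ne x₀ x (Ne.symm hx))], hψ] at h1
  have h2 : MulOpposite.op (B.e x₀) • n x₀ = n x₀ := Subtype.ext (by
    change MulOpposite.op (B.e x₀) • J.mkQ (r.1 x₀) = J.mkQ (r.1 x₀)
    rw [← map_smul, op_smul_eq_mul, hr])
  have h3 : MulOpposite.op (B.φ x₀ (B.f x₀)) • n x₀ - MulOpposite.op (B.e x₀) • n x₀ = 0 :=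
    (sub_smul _ _ _).symm.trans (hkill _ (B.φ_self x₀) (n x₀))
  rw [h1, h2, zero_sub, neg_eq_zero] at h3
  exact hx₀ ((Submodule.Quotient.mk_eq_zero J).1 (congrArg Subtype.val h3))

end Contratensor

/-! ### Epimorphisms and projectivity. -/

namespace Contramodule

variable {R : Type u} [Ring R] [UniformSpace R] [IsUniformAddGroup R] [IsTopologicalRing R]
  [CompleteSpace R] [T2Space R] [IsLinearTopology Rᵐᵒᵖ R]

open FormalSum

section Quotient

variable {D : Contramodule R} {B : AddSubgroup D.carrier}

/-- Makes the contraaction on the quotient independent of the representatives chosen by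
`Quotient.out`. -/
theorem mk_lin_congr
    (hB : ∀ {Y : Type u} (g : Y → D.carrier), (∀ y, g y ∈ B) → ∀ r : FormalSum R Y, lin g r ∈ B)
    {Y : Type u} {g g' : Y → D.carrier}
    (h : ∀ y, QuotientAddGroup.mk' B (g y) = QuotientAddGroup.mk' B (g' y)) (r : FormalSum R Y) :
    QuotientAddGroup.mk' B (lin g r) = QuotientAddGroup.mk' B (lin g' r) := by
  rw [← sub_eq_zero, ← map_sub, ← lin_sub_left]
  refine (QuotientAddGroup.eq_zero_iff _).2 (hB _ (fun y => ?_) r)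
  rw [← QuotientAddGroup.eq_zero_iff]
  exact (map_sub (QuotientAddGroup.mk' B) _ _).trans (sub_eq_zero.2 (h y))

/-- The quotient of a contramodule by a subcontramodule. -/
noncomputable def quotient (D : Contramodule R) (B : AddSubgroup D.carrier)
    (hB : ∀ {Y : Type u} (g : Y → D.carrier), (∀ y, g y ∈ B) → ∀ r : FormalSum R Y,
      lin g r ∈ B) : Contramodule R where
  carrier := D.carrier ⧸ B
  act r := QuotientAddGroup.mk' B (lin Quotient.out r)
  act_point c := by
    rw [lin_point]
    exact Quotient.out_eq c
  act_assoc r := by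
    have h : FormalSum.join r = FormalSum.bind id r := by
      rw [FormalSum.bind, AddMonoidHom.comp_apply, FormalSum.map_id]
    rw [lin_map, h, lin_bind]
    exact mk_lin_congr hB (fun s => Quotient.out_eq _) r

variable (hB : ∀ {Y : Type u} (g : Y → D.carrier), (∀ y, g y ∈ B) → ∀ r : FormalSum R Y,
      lin g r ∈ B)

/-- The projection onto the quotient contramodule. -/
noncomputable def toQuotient : D ⟶ quotient D B hB where
  toFun := QuotientAddGroup.mk' B
  map_act r := by
    change _ = QuotientAddGroup.mk' B (lin Quotient.out (FormalSum.map (QuotientAddGroup.mk' B) r))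
    rw [lin_map, ← lin_id]
    exact mk_lin_congr hB (fun c => (Quotient.out_eq _).symm) r

/-- The zero homomorphism into the quotient contramodule. -/
noncomputable def zeroToQuotient : D ⟶ quotient D B hB where
  toFun _ := QuotientAddGroup.mk' B 0
  map_act r := by
    change _ = QuotientAddGroup.mk' B
      (lin Quotient.out (FormalSum.map (fun _ : D.carrier => QuotientAddGroup.mk' B 0) r))
    rw [lin_map]
    have h := (linHom (C := D) r).map_zero
    change lin 0 r = 0 at h
    rw [← h]
    exact mk_lin_congr hB (fun c => by rw [h]; exact (Quotient.out_eq _).symm) r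

end Quotient

/-- The image is closed under infinite linear combinations, so the quotient by it is a contramodule.
The projection and the zero map agree on the image, hence everywhere. -/
theorem surjective_of_epi {C D : Contramodule R} (f : C ⟶ D) [Epi f] :
    Function.Surjective f.toFun := by
  have hlin : ∀ r, lin f.toFun r = f.toFun (C.act r) := fun r => (f.map_act r).symm
  have hB : ∀ {Y : Type u} (g : Y → D.carrier), (∀ y, g y ∈ (lin f.toFun).range) →
      ∀ r : FormalSum R Y, lin g r ∈ (lin f.toFun).range := fun g hg r => by
    choose s hs using hg
    refine ⟨FormalSum.bind s r, ?_⟩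
    rw [lin_bind]
    congr 2
    exact funext hs
  have hc : f ≫ toQuotient hB = f ≫ zeroToQuotient hB := by
    refine Hom.ext (funext fun c => ?_)
    change QuotientAddGroup.mk' (lin f.toFun).range (f.toFun c) = QuotientAddGroup.mk' _ 0
    rw [map_zero]
    refine (QuotientAddGroup.eq_zero_iff _).2 ⟨point c, ?_⟩
    rw [lin_point]
  have hq := (cancel_epi f).1 hc
  intro d
  have h1 : QuotientAddGroup.mk' (lin f.toFun).range d = QuotientAddGroup.mk' _ 0 :=
    congrFun (congrArg Hom.toFun hq) d
  rw [map_zero] at h1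
  obtain ⟨r, hr⟩ := (QuotientAddGroup.eq_zero_iff _).1 h1
  exact ⟨C.act r, by rw [← hlin, hr]⟩

/-- A retract of a free contramodule is projective. -/
theorem projective_of_section {F : Contramodule R} {X : Type u} (f : X → F.carrier)
    (ρ : F.carrier → FormalSum R X) (hρ : ∀ c, lin f (ρ c) = c)
    (hact : ∀ r, ρ (F.act r) = FormalSum.bind ρ r) : Projective F where
  factors {E A} h g _ := by
    choose a ha using fun x => surjective_of_epi g (h.toFun (f x))
    refine ⟨⟨fun c => lin a (ρ c), fun r => ?_⟩, Hom.ext (funext fun c => ?_)⟩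
    · rw [hact, lin_bind]
      rfl
    · change g.toFun (lin a (ρ c)) = h.toFun c
      rw [hom_lin]
      conv_rhs => rw [← hρ c, hom_lin]
      congr 2
      exact funext ha

end Contramodule

/-! ### Assembly of the proof. -/

section Main

variable {R : Type u} [Ring R] [UniformSpace R] [IsUniformAddGroup R] [IsTopologicalRing R]
  [CompleteSpace R] [T2Space R] [IsLinearTopology Rᵐᵒᵖ R]

open Contramodule FormalSum

theorem CoordinateSystem.projective {H : Ideal R} {Γ : Type u} {D : SemisimpleSystem H Γ}
    {F : Contramodule R} {X : Type u} (B : CoordinateSystem D F X)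
    (hT : IsTopLeftTNilpotent H) (hF : F.Flat) : Projective F := by
  choose ρ hρe hρ using B.exists_lin_eq hT
  refine projective_of_section B.f ρ hρ fun r => ?_
  -- Both sides are normalized by the e_x and have the same value in F, so injectivity identifies
  -- them; the choice of ρ is thus automatically a morphism.
  refine sub_eq_zero.1 (B.eq_zero_of_lin_eq_zero hT hF (fun x => ?_) ?_)
  · have h1 : mulRight B.e (FormalSum.bind ρ r) = FormalSum.bind ρ r := by
      rw [mulRight, FormalSum.bind_bind]
      congr 2
      exact funext fun c => ext_apply fun x => (mulRight_apply B.e (ρ c) x).trans (hρe c x)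
    have h2 : (FormalSum.bind ρ r).1 x * B.e x = (FormalSum.bind ρ r).1 x := by
      rw [← mulRight_apply, h1]
    change ((ρ (F.act r)).1 x - (FormalSum.bind ρ r).1 x) * B.e x =
      (ρ (F.act r)).1 x - (FormalSum.bind ρ r).1 x
    rw [sub_mul, hρe, h2]
  · rw [map_sub, hρ, lin_bind, sub_eq_zero]
    simp only [hρ]
    exact (lin_id r).symm

theorem exists_semisimpleSystem (H : Ideal R) [H.IsTwoSided] (hH : IsStronglyClosed H)
    {Γ : Type v} (S : Γ → Type w) [∀ γ, Ring (S γ)] [∀ γ, TopologicalSpace (S γ)]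
    [∀ γ, DiscreteTopology (S γ)] [∀ γ, Nontrivial (S γ)] [∀ γ, IsSemisimpleRing (S γ)]
    (e : R ⧸ H ≃+* ((γ : Γ) → S γ)) (he : IsHomeomorph e) :
    ∃ Γ' : Type u, Nonempty (SemisimpleSystem H Γ') := by
  classical
  let q : ∀ γ, R →+* S γ := fun γ =>
    (Pi.evalRingHom S γ).comp (e.toRingHom.comp (Ideal.Quotient.mk H))
  have hq : ∀ γ a, q γ a = e (Ideal.Quotient.mk H a) γ := fun _ _ => rfl
  have hqc : ∀ γ, Continuous (q γ) := fun γ =>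
    (continuous_apply γ).comp (he.continuous.comp H.continuous_mkQ)
  have hqs : ∀ γ, Function.Surjective (q γ) := fun γ =>
    (Function.surjective_eval γ).comp (e.surjective.comp Ideal.Quotient.mk_surjective)
  choose ε hε using fun γ =>
    Ideal.Quotient.mk_surjective (I := H) (e.symm (Pi.single γ (1 : S γ)))
  have hqε : ∀ γ γ', q γ' (ε γ) = (Pi.single γ (1 : S γ) : ∀ γ, S γ) γ' := fun γ γ' => by
    rw [hq, hε, e.apply_symm_apply]
  have hinj : Function.Injective ε := fun γ γ' h => by
    by_contra hne
    have h1 := hqε γ γ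
    rw [h, hqε, Pi.single_eq_same, Pi.single_eq_of_ne hne] at h1
    exact zero_ne_one h1
  have : Small.{u} Γ := small_of_injective hinj
  -- The central idempotents are distinct because each S_γ is nontrivial; they embed Γ in R, so it
  -- can be moved to the universe of R.
  let σ : Shrink.{u} Γ ≃ Γ := (equivShrink Γ).symm
  refine ⟨Shrink.{u} Γ, ⟨{
    K := fun γ => RingHom.ker (q (σ γ))
    isTwoSided := fun γ => inferInstance
    isOpen := fun γ => (isOpen_discrete {(0 : S (σ γ))}).preimage (hqc (σ γ))
    semisimple := fun γ =>
      (RingHom.quotientKerEquivOfSurjective (hqs (σ γ))).symm.isSemisimpleRing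
    ε := fun γ => ε (σ γ)
    ε_mem := fun γ γ' hne => by
      rw [RingHom.mem_ker, hqε, Pi.single_eq_of_ne (σ.injective.ne hne)]
    ε_sub_one_mem := fun γ => by
      rw [RingHom.mem_ker, map_sub, hqε, Pi.single_eq_same, map_one, sub_self]
    mem_iff := fun a => ?_
    exists_lift := fun {X} s hs => ?_ }⟩⟩
  · rw [← Ideal.Quotient.eq_zero_iff_mem, ← e.map_eq_zero_iff, funext_iff]
    exact ⟨fun h γ => h (σ γ), fun h γ => by
      obtain ⟨γ, rfl⟩ := σ.surjective γ
      exact h γ⟩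
  -- In a product of discrete rings, converging to zero means that each component is eventually
  -- zero, which is the finiteness hypothesis; strong closedness then lifts the family.
  · have ht : Tendsto (fun x => Ideal.Quotient.mk H (s x)) cofinite (𝓝 0) := by
      rw [he.isEmbedding.tendsto_nhds_iff, map_zero, tendsto_pi_nhds]
      intro γ
      obtain ⟨γ, rfl⟩ := σ.surjective γ
      rw [Pi.zero_apply, nhds_discrete, tendsto_pure]
      exact hs γ
    obtain ⟨r, hr⟩ := hH.surjective X ⟨_, ht⟩
    refine ⟨r, fun x => ?_⟩
    rw [← Ideal.Quotient.mk_eq_mk_iff_sub_mem]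
    exact congrFun (congrArg Subtype.val hr) x

end Main

theorem corollary8p4 {R : Type u} [Ring R] [UniformSpace R] [IsUniformAddGroup R]
    [IsTopologicalRing R] [CompleteSpace R] [T2Space R] [IsLinearTopology Rᵐᵒᵖ R]
    (H : Ideal R) [H.IsTwoSided] (hH : IsStronglyClosed H) (hT : IsTopLeftTNilpotent H)
    {Γ : Type v} (S : Γ → Type w) [∀ γ, Ring (S γ)] [∀ γ, TopologicalSpace (S γ)]
    [∀ γ, DiscreteTopology (S γ)] [∀ γ, IsSimpleRing (S γ)] [∀ γ, IsArtinianRing (S γ)]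
    (e : R ⧸ H ≃+* ((γ : Γ) → S γ)) (he : IsHomeomorph e)
    (F : Contramodule R) (hF : F.Flat) :
    Projective F := by
  have := fun γ => (IsSimpleRing.isSemisimpleRing_iff_isArtinianRing (R := S γ)).2 inferInstance
  obtain ⟨Γ', ⟨D⟩⟩ := exists_semisimpleSystem H hH S e he
  obtain ⟨X, ⟨B⟩⟩ := D.exists_coordinateSystem hT F
  exact B.projective hT hF
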